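/- Let $(\Omega,\mathcal F,\mathbb P)$ be a probability space, and let $f:\mathbb R^d\to\mathbb R$ be continuously differentiable with $\inf f>-\infty$ and, for some $\alpha\in(0,1]$ and $A>0$, $\|\nabla f(x)-\nabla f(y)\|\le A\|x-y\|^\alpha$ for all $x,y\in\mathbb R^d$. Let $(\xi_t)_{t\ge0}$ be independent random variables with values in a measurable space $S$, and let $g:\mathbb R^d\times S\to\mathbb R^d$ be measurable. Suppose that there are constants $\sigma^2,C>0$ such that for all $t\ge 0$ and all $x\in\mathbb R^d$ $$\mathbb E[g(x,\xi_t)]=\nabla f(x),\qquad \mathbb E\big[\|g(x,\xi_t)-\nabla f(x)\|^2\big]\le\sigma^2+C\|\nabla f(x)\|^2 .$$ Let $(\gamma_t)_{t\ge0}$ be real random variables such that, almost surely, $\gamma_t\ge0$ for all $t$, $\sum_{t}\gamma_t=\infty$ and $\sum_t\gamma_t^{1+\alpha}<\infty$. Suppose that for every $t\ge0$ the variable $\xi_t$ is independent of the history $\mathcal F_t=\sigma(\gamma_0,\xi_0,\dots,\gamma_{t-1},\xi_{t-1},\gamma_t)$. Let $\beta\in[0,1)$, $s\ge0$ and $x_0\in\mathbb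 R^d$. Put $y_0^s=x_0$ and define, for $t\ge0$ and pathwise on $\Omega$, with $g_t=g(x_t,\xi_t)$, $$y_{t+1}=x_t-\gamma_tg_t,\qquad y_{t+1}^s=x_t-s\gamma_tg_t,\qquad x_{t+1}=y_{t+1}+\beta\,(y_{t+1}^s-y_t^s).$$ Then: (i) $f(x_t)$ converges (to a finite limit) almost surely; (ii) $\nabla f(x_t)\to0$ almost surely; (iii) if, in addition, for all $a<b$ the function $f$ has only finitely many critical points in $\{x\in\mathbb R^d: a\le f(x)\le b\}$, and $\lim_{\|x\|\to\infty}f(x)=+\infty$, then $x_t$ converges almost surely. -/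

import Mathlib

open MeasureTheory ProbabilityTheory Filter Topology

/-- The state `(x_t, y_t^s)` of the Stochastic Unified Momentum method along one sample path, with
momentum factor `β`, parameter `s`, stepsizes `γ t`, oracle `g`, samples `ξ t` and initial
point `x₀`:
`x_0 = y_0^s = x₀`, and with `G_t = g(x_t, ξ_t)`
`y_{t+1} = x_t - γ_t G_t`, `y_{t+1}^s = x_t - s γ_t G_t`,
`x_{t+1} = y_{t+1} + β (y_{t+1}^s - y_t^s)`. -/
noncomputable def sumState {d : ℕ} {S : Type*} (β s : ℝ)
    (g : EuclideanSpace ℝ (Fin d) → S → EuclideanSpace ℝ (Fin d))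
    (x₀ : EuclideanSpace ℝ (Fin d)) (γ : ℕ → ℝ) (ξ : ℕ → S) :
    ℕ → EuclideanSpace ℝ (Fin d) × EuclideanSpace ℝ (Fin d)
  | 0 => (x₀, x₀)
  | t + 1 =>
    let x := (sumState β s g x₀ γ ξ t).1
    let ys := (sumState β s g x₀ γ ξ t).2
    let G := g x (ξ t)
    let y' := x - γ t • G
    let ys' := x - (s * γ t) • G
    (y' + β • (ys' - ys), ys')

/-- The iterates `x_t` of the Stochastic Unified Momentum method, as random variables: the stepsizes
and the samples are random, and the method is run along each sample path. -/
noncomputable def sumIterate {d : ℕ} {S Ω : Type*} (β s : ℝ)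
    (g : EuclideanSpace ℝ (Fin d) → S → EuclideanSpace ℝ (Fin d))
    (x₀ : EuclideanSpace ℝ (Fin d)) (γ : ℕ → Ω → ℝ) (ξ : ℕ → Ω → S)
    (t : ℕ) (ω : Ω) : EuclideanSpace ℝ (Fin d) :=
  (sumState β s g x₀ (fun i => γ i ω) (fun i => ξ i ω) t).1

/-- The history `ℱ_t = σ(γ_0, ξ_0, γ_1, ξ_1, …, γ_{t-1}, ξ_{t-1}, γ_t)`. -/
@[reducible] def sumHistory {S Ω : Type*} [MeasurableSpace S] (γ : ℕ → Ω → ℝ) (ξ : ℕ → Ω → S) (t : ℕ) :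
    MeasurableSpace Ω :=
  (⨆ i : ℕ, ⨆ _ : i ≤ t, MeasurableSpace.comap (γ i) inferInstance) ⊔
    (⨆ i : ℕ, ⨆ _ : i < t, MeasurableSpace.comap (ξ i) inferInstance)

/-! The proof changes coordinates. With `v_t = x_t - y_t^s` and `z_t = x_t + β/(1-β) v_t`, the
method becomes `z_{t+1} = z_t - γ_t/(1-β) g_t` and `v_{t+1} = β v_t - (1+βs-s) γ_t g_t`: plain
stochastic gradient steps whose gradient is evaluated at the shifted point `x_t`, together with a
contracting buffer.

The Lyapunov function is `f(z) + K‖v‖^(1+α)`. By Hölder continuity a step lowers it by `γ‖∇f(x)‖² +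
‖v‖^(1+α)`, up to a centered term and an error of order `γ^(1+α) (1 + ‖∇f(x)‖² + ‖N‖²)`, where `N`
is the noise (`exists_lyapunov_step`). As `f` is bounded below, `‖∇f‖²` is at most a multiple of `1
+ f - inf f`, so in conditional mean the error is a summable multiple of the Lyapunov function.
`robbins_siegmund` then shows that `f(z_t)` converges, `v_t → 0` and `∑ γ_t‖∇f(x_t)‖² < ∞`, also in
mean. Hence the martingale `∑ γ_t N_t` is bounded in `L²` and converges.

The rest is pathwise. Adding the accumulated noise to `z` gives a sequence `w` with steps
`-γ_t/(1-β) ∇f(x_t)` for which `x - w` converges. Since `∑ γ_t = ∞`, the gradient is small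
infinitely often; while it stays at least `ε`, `w` moves by at most `ε⁻¹ ∑ γ‖∇f‖²` up to a constant,
so uniform continuity keeps it small (`tendsto_zero_of_summable_mul_sq`). Thus `∇f(x_t) → 0` and
`f(x_t) - f(z_t) → 0`. For (iii), cluster points are critical points at the limiting level, hence
finitely many, and vanishing increments prevent travel between them.

The argument needs a deterministic bound on `∑ γ_t^(1+α)`. The stepsizes are therefore truncated at
each integer level `M`; almost every path is untouched for some `M`. -/

section Deterministic

open scoped RealInnerProductSpace

/-! ### Elementary inequalities for real powers. -/

lemma Real.rpow_le_one_add_sq {p u : ℝ} (hp0 : 0 ≤ p) (hp : p ≤ 2) (hu : 0 ≤ u) :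
    u ^ p ≤ 1 + u ^ 2 := by
  rcases le_total u 1 with h | h
  · have := Real.rpow_le_one hu h hp0
    nlinarith [sq_nonneg u]
  · have := Real.rpow_le_rpow_of_exponent_le h hp
    rw [Real.rpow_two] at this
    linarith

lemma Real.rpow_mul_le_add_rpow {α u w : ℝ} (hα : 0 ≤ α) (hu : 0 ≤ u) (hw : 0 ≤ w) :
    u ^ α * w ≤ u ^ (1 + α) + w ^ (1 + α) := by
  have key : ∀ y : ℝ, 0 ≤ y → y ^ α * y = y ^ (1 + α) := fun y hy => by
    rw [Real.rpow_add_of_nonneg hy zero_le_one hα, Real.rpow_one, mul_comm]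
  rcases le_total u w with h | h
  · calc u ^ α * w ≤ w ^ α * w := by gcongr
      _ = w ^ (1 + α) := key w hw
      _ ≤ _ := le_add_of_nonneg_left (by positivity)
  · calc u ^ α * w ≤ u ^ α * u := by gcongr
      _ = u ^ (1 + α) := key u hu
      _ ≤ _ := le_add_of_nonneg_right (by positivity)

/-! ### Functions with Hölder continuous gradient. -/

variable {E : Type*} [NormedAddCommGroup E] [InnerProductSpace ℝ E] [CompleteSpace E]

/-- `f` is differentiable and its gradient is Hölder continuous with exponent `α ∈ (0, 1]` and
constant `A > 0`. -/
structure HolderGradient (f : E → ℝ) (α A : ℝ) : Prop where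
  differentiable : Differentiable ℝ f
  pos : 0 < α
  le_one : α ≤ 1
  const_pos : 0 < A
  holder : ∀ x y, ‖gradient f x - gradient f y‖ ≤ A * ‖x - y‖ ^ α

namespace HolderGradient

variable {f : E → ℝ} {α A : ℝ}

lemma uniformContinuous (h : HolderGradient f α A) : UniformContinuous (gradient f) := by
  have hA : (0 : ℝ) ≤ A := h.const_pos.le
  have hH : HolderWith A.toNNReal α.toNNReal (gradient f) := by
    intro x y
    rw [Real.coe_toNNReal α h.pos.le, edist_dist, edist_dist,
      ENNReal.ofReal_rpow_of_nonneg dist_nonneg h.pos.le]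
    change _ ≤ ENNReal.ofReal A * _
    rw [← ENNReal.ofReal_mul hA]
    apply ENNReal.ofReal_le_ofReal
    simpa [dist_eq_norm] using h.holder x y
  exact hH.uniformContinuous (Real.toNNReal_pos.2 h.pos)

/-- The mean value inequality for `f` minus its linearization at `x`, whose derivative on the
segment is at most `A‖y - x‖^α`. The sharper constant `A/(1+α)` is not needed. -/
lemma abs_sub_sub_inner_le (h : HolderGradient f α A) (x y : E) :
    |f y - f x - ⟪gradient f x, y - x⟫| ≤ A * ‖y - x‖ ^ (1 + α) := by
  have hA := h.const_pos
  have key := (convex_segment x y).norm_image_sub_le_of_norm_fderiv_le' (f := f)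
    (φ := fderiv ℝ f x) (C := A * ‖y - x‖ ^ α) (fun z _ => h.differentiable z)
    (fun z hz => by
      have h1 : ‖fderiv ℝ f z - fderiv ℝ f x‖ = ‖gradient f z - gradient f x‖ := by
        rw [← toDual_gradient, ← toDual_gradient, ← map_sub, LinearIsometryEquiv.norm_map]
      rw [h1]
      refine (h.holder z x).trans ?_
      have : ‖z - x‖ ≤ ‖y - x‖ := by
        obtain ⟨a, b, ha, hb, hab, rfl⟩ := hz
        have : a • x + b • y - x = b • (y - x) := by
          rw [show a = 1 - b by linarith]; module
        rw [this, norm_smul, Real.norm_of_nonneg hb]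
        exact mul_le_of_le_one_left (norm_nonneg _) (by linarith)
      have := Real.rpow_le_rpow (norm_nonneg _) this h.pos.le
      gcongr) (left_mem_segment ℝ x y) (right_mem_segment ℝ x y)
  rw [inner_gradient_left, ← Real.norm_eq_abs]
  refine key.trans_eq ?_
  rw [Real.rpow_add_of_nonneg (norm_nonneg _) zero_le_one h.pos.le, Real.rpow_one]
  ring

/-- A gradient step of fixed size `θ` with `A θ^α = 1/2` lowers `f` by at least `θ/2 ‖∇f‖²` when
`‖∇f‖ ≥ 1`, and `f` cannot fall below `m`. -/
lemma exists_sq_norm_gradient_le (h : HolderGradient f α A) {m : ℝ} (hm : ∀ x, m ≤ f x) :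
    ∃ c, 0 ≤ c ∧ ∀ x, ‖gradient f x‖ ^ 2 ≤ c * (1 + (f x - m)) := by
  have hA := h.const_pos
  have hα := h.pos
  set θ : ℝ := (1 / (2 * A)) ^ (1 / α) with hθ
  have hθ0 : 0 < θ := by positivity
  have hθα : θ ^ α = 1 / (2 * A) := by
    rw [hθ, ← Real.rpow_mul (by positivity), one_div_mul_cancel hα.ne', Real.rpow_one]
  refine ⟨1 + 2 / θ, by positivity, fun x => ?_⟩
  have hfx := hm x
  set G := ‖gradient f x‖ with hG
  have hG0 : 0 ≤ G := norm_nonneg _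
  rcases le_total G 1 with h1 | h1
  · have : G ^ 2 ≤ 1 := by nlinarith
    have : 0 ≤ 2 / θ := by positivity
    nlinarith
  · have hd := (abs_le.1 (h.abs_sub_sub_inner_le x (x - θ • gradient f x))).2
    have e1 : x - θ • gradient f x - x = -(θ • gradient f x) := by abel
    rw [e1, inner_neg_right, inner_smul_right, real_inner_self_eq_norm_sq, norm_neg, norm_smul,
      Real.norm_of_nonneg hθ0.le, ← hG, Real.mul_rpow hθ0.le hG0,
      Real.rpow_add_of_nonneg hθ0.le zero_le_one hα.le, Real.rpow_one, hθα] at hd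
    have h2 := Real.rpow_le_rpow_of_exponent_le h1 (show 1 + α ≤ 2 by linarith [h.le_one])
    rw [Real.rpow_two] at h2
    have e2 : A * (θ * (1 / (2 * A)) * G ^ (1 + α)) = θ / 2 * G ^ (1 + α) := by
      field_simp
    rw [e2] at hd
    have hm' := hm (x - θ • gradient f x)
    have h3 : θ / 2 * G ^ (1 + α) ≤ θ / 2 * G ^ 2 := by gcongr
    have h4 : θ / 2 * G ^ 2 ≤ f x - m := by linarith
    have h5 : G ^ 2 = 2 / θ * (θ / 2 * G ^ 2) := by field_simp
    have : 2 / θ * (θ / 2 * G ^ 2) ≤ 2 / θ * (f x - m) := by gcongr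
    have : 0 ≤ 2 / θ := by positivity
    nlinarith

/-- Linear growth of the gradient, and quadratic growth of `f` below, serve to propagate square
integrability along the iterates. -/
lemma norm_gradient_le (h : HolderGradient f α A) (x : E) :
    ‖gradient f x‖ ≤ ‖gradient f 0‖ + A * (1 + ‖x‖) := by
  have hA := h.const_pos
  have h1 := h.holder x 0
  rw [sub_zero] at h1
  have h2 : ‖x‖ ^ α ≤ 1 + ‖x‖ := by
    rcases le_total ‖x‖ 1 with hx | hx
    · linarith [Real.rpow_le_one (norm_nonneg x) hx h.pos.le, norm_nonneg x]
    · have := Real.rpow_le_rpow_of_exponent_le hx h.le_one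
      rw [Real.rpow_one] at this
      linarith
  calc ‖gradient f x‖ ≤ ‖gradient f 0‖ + ‖gradient f x - gradient f 0‖ := norm_le_insert' _ _
    _ ≤ _ := by gcongr; exact h1.trans (by gcongr)

lemma abs_le_quadratic (h : HolderGradient f α A) (x : E) :
    |f x| ≤ |f 0| + (‖gradient f 0‖ + A) * (1 + ‖x‖ ^ 2) := by
  have hA := h.const_pos
  have h1 := h.abs_sub_sub_inner_le 0 x
  rw [sub_zero] at h1
  have h2 := abs_real_inner_le_norm (gradient f 0) x
  have h3 := Real.rpow_le_one_add_sq (p := 1 + α) (by linarith [h.pos]) (by linarith [h.le_one])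
    (norm_nonneg x)
  have h4 : ‖x‖ ≤ 1 + ‖x‖ ^ 2 := by nlinarith [sq_nonneg (‖x‖ - 1), norm_nonneg x]
  have h5 : |f x| ≤ |f x - f 0 - ⟪gradient f 0, x⟫| + |f 0| + |⟪gradient f 0, x⟫| := by
    calc |f x| = |(f x - f 0 - ⟪gradient f 0, x⟫) + f 0 + ⟪gradient f 0, x⟫| := by ring_nf
      _ ≤ _ := abs_add_three _ _ _
  have h6 : A * ‖x‖ ^ (1 + α) ≤ A * (1 + ‖x‖ ^ 2) := by gcongr
  have h7 : ‖gradient f 0‖ * ‖x‖ ≤ ‖gradient f 0‖ * (1 + ‖x‖ ^ 2) := by gcongr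
  linarith

/-- With `b = β/(1-β)` the argument `z - b • v` is the iterate `x`, so the gradient at `x` is
controlled by the Lyapunov function at `(z, v)`. Here `α ≤ 1` enters through `2α ≤ 1 + α`. -/
lemma exists_sq_norm_gradient_sub_le (h : HolderGradient f α A) {m : ℝ} (hm : ∀ x, m ≤ f x)
    {b : ℝ} (hb : 0 ≤ b) :
    ∃ c, 0 ≤ c ∧ ∀ z v, ‖gradient f (z - b • v)‖ ^ 2 ≤ c * (1 + (f z - m) + ‖v‖ ^ (1 + α)) := by
  obtain ⟨c, hc0, hc⟩ := h.exists_sq_norm_gradient_le hm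
  have hA := h.const_pos
  have hα := h.pos
  refine ⟨2 * c + 2 * (A * b ^ α) ^ 2, by positivity, fun z v => ?_⟩
  have h1 := h.holder (z - b • v) z
  have e1 : ‖z - b • v - z‖ = b * ‖v‖ := by
    rw [sub_sub_cancel_left, norm_neg, norm_smul, Real.norm_of_nonneg hb]
  rw [e1, Real.mul_rpow hb (norm_nonneg _), ← mul_assoc] at h1
  have h2 : ‖gradient f (z - b • v)‖ ≤ ‖gradient f z‖ + A * b ^ α * ‖v‖ ^ α :=
    (norm_le_insert' _ (gradient f z)).trans (by gcongr)
  have h3 : ‖gradient f (z - b • v)‖ ^ 2 ≤ 2 * ‖gradient f z‖ ^ 2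
      + 2 * (A * b ^ α) ^ 2 * (‖v‖ ^ α) ^ 2 := by
    have := pow_le_pow_left₀ (norm_nonneg _) h2 2
    nlinarith [sq_nonneg (‖gradient f z‖ - A * b ^ α * ‖v‖ ^ α)]
  have h4 : (‖v‖ ^ α) ^ 2 ≤ 1 + ‖v‖ ^ (1 + α) := by
    rw [← Real.rpow_mul_natCast (norm_nonneg _)]
    rcases le_total ‖v‖ 1 with hv | hv
    · have := Real.rpow_le_one (norm_nonneg v) hv (show 0 ≤ α * (2 : ℕ) by positivity)
      have : 0 ≤ ‖v‖ ^ (1 + α) := by positivity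
      linarith
    · have := Real.rpow_le_rpow_of_exponent_le hv
        (show α * (2 : ℕ) ≤ 1 + α by push_cast; linarith [h.le_one])
      linarith
  have h5 := hc z
  have h6 : 2 * (A * b ^ α) ^ 2 * (‖v‖ ^ α) ^ 2 ≤ 2 * (A * b ^ α) ^ 2 * (1 + ‖v‖ ^ (1 + α)) := by
    gcongr
  have h7 : 0 ≤ 2 * (A * b ^ α) ^ 2 * (f z - m) :=
    mul_nonneg (by positivity) (by linarith [hm z])
  have h8 : 0 ≤ 2 * c * ‖v‖ ^ (1 + α) := by positivity
  linarith

/-- One step of the momentum method decreases the Lyapunov function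
`f z + K ‖v‖ ^ (1 + α)` up to error terms. -/
lemma exists_lyapunov_step (h : HolderGradient f α A) {β : ℝ} (hβ : 0 ≤ β) (hβ1 : β < 1) (c : ℝ) :
    ∃ K κ, 1 ≤ K ∧ 0 ≤ κ ∧ ∀ (γ : ℝ) (z v x N : E), 0 ≤ γ → x = z - (β / (1 - β)) • v →
      f (z - (γ / (1 - β)) • (gradient f x + N))
          + K * ‖β • v - (c * γ) • (gradient f x + N)‖ ^ (1 + α)
        ≤ f z + K * ‖v‖ ^ (1 + α) - γ * ‖gradient f x‖ ^ 2 - ‖v‖ ^ (1 + α)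
          + κ * γ ^ (1 + α) * (1 + ‖gradient f x‖ ^ 2 + ‖N‖ ^ 2)
          - γ / (1 - β) * ⟪gradient f z, N⟫ := by
  have hA := h.const_pos
  have hα := h.pos
  have hα1 := h.le_one
  have hβ' : 0 < 1 - β := by linarith
  set b := β / (1 - β) with hb
  have hb0 : 0 ≤ b := by positivity
  set D := A * b ^ α with hD
  have hD0 : 0 ≤ D := by positivity
  -- The contraction of the buffer gains `K(1-β)‖v‖^(1+α)`: the share `D` pays for evaluating the
  -- gradient at `x` instead of `z`, and the share `1` remains as decrease.
  set K := (D + 1) / (1 - β) with hK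
  have hKβ : K * (1 - β) = D + 1 := by rw [hK]; field_simp
  have hK1 : 1 ≤ K := by rw [hK, le_div_iff₀ hβ']; linarith
  have hK0 : 0 ≤ K := by linarith
  set κ := (2 * A + 2 * K * |c| ^ (1 + α) + D) * (1 / (1 - β)) ^ (1 + α) with hκ
  refine ⟨K, κ, hK1, by positivity, fun γ z v x N hγ hx => ?_⟩
  set η := γ / (1 - β) with hη
  have hη0 : 0 ≤ η := by positivity
  have hγη : γ ≤ η := by rw [hη, le_div_iff₀ hβ']; nlinarith
  set G := ‖gradient f x‖ with hG
  have hG0 : 0 ≤ G := norm_nonneg _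
  set q := gradient f x + N with hq
  have hηp : η ^ (1 + α) = (1 / (1 - β)) ^ (1 + α) * γ ^ (1 + α) := by
    rw [hη, ← Real.mul_rpow (by positivity) hγ]; congr 1; ring
  have hηp0 : 0 ≤ η ^ (1 + α) := by positivity
  -- the size of the stochastic gradient
  have hqn : ‖q‖ ^ (1 + α) ≤ 1 + 2 * G ^ 2 + 2 * ‖N‖ ^ 2 := by
    have h1 := Real.rpow_le_one_add_sq (p := 1 + α) (by linarith) (by linarith) (norm_nonneg q)
    have h2 : ‖q‖ ^ 2 ≤ (G + ‖N‖) ^ 2 := pow_le_pow_left₀ (norm_nonneg _) (norm_add_le _ _) 2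
    nlinarith [sq_nonneg (G - ‖N‖)]
  -- descent of `f`
  have hd := (abs_le.1 (h.abs_sub_sub_inner_le z (z - η • q))).2
  rw [sub_sub_cancel_left, inner_neg_right, inner_smul_right, norm_neg, norm_smul,
    Real.norm_of_nonneg hη0, Real.mul_rpow hη0 (norm_nonneg _)] at hd
  have hin : ⟪gradient f z, q⟫ = ⟪gradient f z, N⟫ + ⟪gradient f z - gradient f x, gradient f x⟫
      + G ^ 2 := by
    rw [hq, inner_add_right, inner_sub_left, real_inner_self_eq_norm_sq]; ring
  have hcs : -⟪gradient f z - gradient f x, gradient f x⟫ ≤ D * ‖v‖ ^ α * G := by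
    have h1 := neg_le_of_abs_le (abs_real_inner_le_norm (gradient f z - gradient f x) (gradient f x))
    have h2 := h.holder z x
    rw [hx, sub_sub_cancel, norm_smul, Real.norm_of_nonneg hb0,
      Real.mul_rpow hb0 (norm_nonneg _), ← mul_assoc, ← hx] at h2
    have : ‖gradient f z - gradient f x‖ * ‖gradient f x‖ ≤ A * b ^ α * ‖v‖ ^ α * ‖gradient f x‖ := by
      gcongr
    linarith
  have hyoung : η * (D * ‖v‖ ^ α * G) ≤ D * (‖v‖ ^ (1 + α) + η ^ (1 + α) * (1 + G ^ 2)) := by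
    have h1 := Real.rpow_mul_le_add_rpow hα.le (norm_nonneg v) (mul_nonneg hη0 hG0)
    rw [Real.mul_rpow hη0 hG0] at h1
    have h2 := Real.rpow_le_one_add_sq (p := 1 + α) (by linarith) (by linarith) hG0
    calc η * (D * ‖v‖ ^ α * G) = D * (‖v‖ ^ α * (η * G)) := by ring
      _ ≤ D * (‖v‖ ^ (1 + α) + η ^ (1 + α) * G ^ (1 + α)) := by gcongr
      _ ≤ _ := by gcongr
  -- contraction of the momentum buffer
  have hv : ‖β • v - (c * γ) • q‖ ^ (1 + α)
      ≤ β * ‖v‖ ^ (1 + α) + |c| ^ (1 + α) * η ^ (1 + α) * ‖q‖ ^ (1 + α) := by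
    -- Since `γ = (1-β)η`, the bound is a convex combination, and convexity of the power keeps the
    -- factor `β` in front of `‖v‖^(1+α)`.
    have h1 : ‖β • v - (c * γ) • q‖ ≤ β * ‖v‖ + (1 - β) * (|c| * η * ‖q‖) := by
      refine (norm_sub_le _ _).trans (le_of_eq ?_)
      rw [norm_smul, norm_smul, Real.norm_of_nonneg hβ, Real.norm_eq_abs, abs_mul,
        abs_of_nonneg hγ, hη]
      field_simp
    have h2 := (convexOn_rpow (p := 1 + α) (by linarith)).2 (x := ‖v‖) (norm_nonneg v)
      (y := |c| * η * ‖q‖) (show (0 : ℝ) ≤ _ by positivity) hβ hβ'.le (by ring)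
    simp only [smul_eq_mul] at h2
    have h3 := Real.rpow_le_rpow (norm_nonneg _) h1 (show 0 ≤ 1 + α by linarith)
    rw [Real.mul_rpow (by positivity) (norm_nonneg q), Real.mul_rpow (abs_nonneg c) hη0] at h2
    have h4 : 0 ≤ |c| ^ (1 + α) * η ^ (1 + α) * ‖q‖ ^ (1 + α) := by positivity
    nlinarith
  have hv' := mul_le_mul_of_nonneg_left hv hK0
  have hq1 : A * (η ^ (1 + α) * ‖q‖ ^ (1 + α)) ≤ A * (η ^ (1 + α) * (1 + 2 * G ^ 2 + 2 * ‖N‖ ^ 2)) := by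
    gcongr
  have hq2 : K * (|c| ^ (1 + α) * η ^ (1 + α) * ‖q‖ ^ (1 + α))
      ≤ K * (|c| ^ (1 + α) * η ^ (1 + α) * (1 + 2 * G ^ 2 + 2 * ‖N‖ ^ 2)) := by
    gcongr
  have hGη : γ * G ^ 2 ≤ η * G ^ 2 := by gcongr
  have hcs' := mul_le_mul_of_nonneg_left hcs hη0
  have hκ' : κ * γ ^ (1 + α) * (1 + G ^ 2 + ‖N‖ ^ 2)
      = (2 * A + 2 * K * |c| ^ (1 + α) + D) * η ^ (1 + α) * (1 + G ^ 2 + ‖N‖ ^ 2) := by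
    rw [hκ, hηp]; ring
  have hfin : A * (η ^ (1 + α) * (1 + 2 * G ^ 2 + 2 * ‖N‖ ^ 2))
      + K * (|c| ^ (1 + α) * η ^ (1 + α) * (1 + 2 * G ^ 2 + 2 * ‖N‖ ^ 2))
      + D * (η ^ (1 + α) * (1 + G ^ 2))
      ≤ (2 * A + 2 * K * |c| ^ (1 + α) + D) * η ^ (1 + α) * (1 + G ^ 2 + ‖N‖ ^ 2) := by
    have e1 : 0 ≤ (A * η ^ (1 + α)) := by positivity
    have e2 : 0 ≤ K * |c| ^ (1 + α) * η ^ (1 + α) := by positivity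
    have e3 : 0 ≤ D * η ^ (1 + α) * ‖N‖ ^ 2 := by positivity
    linarith
  have hvK : K * (β * ‖v‖ ^ (1 + α)) + D * ‖v‖ ^ (1 + α) = K * ‖v‖ ^ (1 + α) - ‖v‖ ^ (1 + α) := by
    have : D = K * (1 - β) - 1 := by linarith
    rw [this]; ring
  rw [hin] at hd
  rw [hκ']
  linarith

end HolderGradient

/-! ### Convergence of deterministic sequences. -/

/-- If `w` performs steps `-η n • h (x n)` with a divergent sum of stepsizes, a summable sum
`∑ η n * ‖h (x n)‖ ^ 2` and a convergent difference `x - w`, then `h (x n)` tends to zero. -/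
lemma tendsto_zero_of_summable_mul_sq {E : Type*} [NormedAddCommGroup E] [NormedSpace ℝ E]
    {h : E → E} (hh : UniformContinuous h) {x w : ℕ → E}
    {η : ℕ → ℝ} (hη : ∀ n, 0 ≤ η n) (hη0 : Tendsto η atTop (𝓝 0))
    (hdiv : Tendsto (fun n => ∑ t ∈ Finset.range n, η t) atTop atTop)
    (hw : ∀ n, w (n + 1) = w n - η n • h (x n)) {e : E}
    (hxw : Tendsto (fun n => x n - w n) atTop (𝓝 e))
    (hsum : Summable fun n => η n * ‖h (x n)‖ ^ 2) :
    Tendsto (fun n => h (x n)) atTop (𝓝 0) := by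
  rw [Metric.tendsto_atTop]
  intro ε' hε'
  obtain ⟨ε, hε, rfl⟩ : ∃ ε, 0 < ε ∧ ε' = 2 * ε := ⟨ε' / 2, by positivity, by ring⟩
  obtain ⟨δ, hδ, huc⟩ := Metric.uniformContinuous_iff.1 hh ε hε
  obtain ⟨T₁, hT₁⟩ := Metric.cauchySeq_iff.1 hxw.cauchySeq (δ / 3) (by positivity)
  obtain ⟨T₂, hT₂⟩ := Metric.cauchySeq_iff.1 hsum.hasSum.tendsto_sum_nat.cauchySeq (ε * (δ / 3))
    (by positivity)
  obtain ⟨T₃, hT₃⟩ := Metric.tendsto_atTop.1 hη0 (δ / 3 / ε) (by positivity)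
  set T := max T₁ (max T₂ T₃) with hT
  have hT1 : T₁ ≤ T := le_max_left _ _
  have hT2 : T₂ ≤ T := (le_max_left _ _).trans (le_max_right _ _)
  have hT3 : T₃ ≤ T := (le_max_right _ _).trans (le_max_right _ _)
  -- If `‖h (x n)‖ ≥ ε` from `T` on, then `η` would be dominated by `ε⁻² η‖h‖²` and summable.
  obtain ⟨n₀, hn₀, hsmall⟩ : ∃ n₀, T ≤ n₀ ∧ ‖h (x n₀)‖ < ε := by
    by_contra! hcon
    have hs : Summable η := by
      rw [← summable_nat_add_iff T]
      refine Summable.of_nonneg_of_le (fun n => hη _) (fun n => ?_)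
        (((summable_nat_add_iff T).2 hsum).mul_left (1 / ε ^ 2))
      have h1 := hcon (n + T) (by omega)
      have h2 : ε ^ 2 ≤ ‖h (x (n + T))‖ ^ 2 := pow_le_pow_left₀ hε.le h1 2
      have h3 := hη (n + T)
      rw [one_div, inv_mul_eq_div, le_div_iff₀ (by positivity)]
      gcongr
    exact not_tendsto_atTop_of_tendsto_nhds hs.hasSum.tendsto_sum_nat hdiv
  -- The index `m` is the last time before `n` at which the norm is below `ε`. The step leaving `m`
  -- costs at most `η m * ε`; each later one satisfies `η‖h‖ ≤ ε⁻¹ η‖h‖²`.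
  have key : ∀ n, n₀ ≤ n → ‖h (x n)‖ < ε ∨ (ε ≤ ‖h (x n)‖ ∧ ∃ m, n₀ ≤ m ∧ m < n ∧ ‖h (x m)‖ < ε ∧
      ‖w n - w m‖ ≤ η m * ε + 1 / ε * ∑ t ∈ Finset.Ico m n, η t * ‖h (x t)‖ ^ 2) := by
    intro n hn
    induction n, hn using Nat.le_induction with
    | base => exact Or.inl hsmall
    | succ n hn ih =>
      rcases lt_or_ge ‖h (x (n + 1))‖ ε with hc | hc
      · exact Or.inl hc
      refine Or.inr ⟨hc, ?_⟩
      rcases ih with ih | ⟨ihn, m, hm, hmn, hms, hb⟩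
      · refine ⟨n, hn, Nat.lt_succ_self n, ih, ?_⟩
        rw [hw, sub_sub_cancel_left, norm_neg, norm_smul, Real.norm_of_nonneg (hη n)]
        have h1 : η n * ‖h (x n)‖ ≤ η n * ε := mul_le_mul_of_nonneg_left ih.le (hη n)
        have h2 : 0 ≤ 1 / ε * ∑ t ∈ Finset.Ico n (n + 1), η t * ‖h (x t)‖ ^ 2 :=
          mul_nonneg (by positivity)
            (Finset.sum_nonneg fun t _ => mul_nonneg (hη t) (by positivity))
        linarith
      · refine ⟨m, hm, by omega, hms, ?_⟩
        rw [Finset.sum_Ico_succ_top hmn.le, hw]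
        have h1 : ‖w n - η n • h (x n) - w m‖ ≤ ‖w n - w m‖ + η n * ‖h (x n)‖ := by
          rw [sub_right_comm]
          refine (norm_sub_le _ _).trans_eq ?_
          rw [norm_smul, Real.norm_of_nonneg (hη n)]
        have h2 : η n * ‖h (x n)‖ ≤ 1 / ε * (η n * ‖h (x n)‖ ^ 2) := by
          rw [one_div, inv_mul_eq_div, le_div_iff₀ hε]
          nlinarith [mul_nonneg (mul_nonneg (hη n) (norm_nonneg (h (x n)))) (sub_nonneg.2 ihn)]
        linarith
  refine ⟨n₀, fun n hn => ?_⟩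
  rw [dist_zero_right]
  rcases key n hn with hc | ⟨-, m, hm, hmn, hms, hb⟩
  · linarith
  have hS : ∑ t ∈ Finset.Ico m n, η t * ‖h (x t)‖ ^ 2 ≤ ε * (δ / 3) := by
    have h1 := hT₂ n (by omega) m (by omega)
    rw [Real.dist_eq, ← Finset.sum_Ico_eq_sub _ hmn.le] at h1
    exact (le_abs_self _).trans h1.le
  have hηm : η m * ε ≤ δ / 3 := by
    have h1 := hT₃ m (by omega)
    rw [Real.dist_eq, sub_zero] at h1
    exact (le_div_iff₀ hε).1 ((le_abs_self _).trans h1.le)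
  have hS' : 1 / ε * ∑ t ∈ Finset.Ico m n, η t * ‖h (x t)‖ ^ 2 ≤ δ / 3 := by
    rw [one_div, inv_mul_eq_div, div_le_iff₀ hε]
    linarith
  have h1 := hT₁ n (by omega) m (by omega)
  rw [dist_eq_norm] at h1
  have h2 : dist (x n) (x m) < δ := by
    rw [dist_eq_norm]
    calc ‖x n - x m‖ = ‖(x n - w n - (x m - w m)) + (w n - w m)‖ := by congr 1; abel
      _ ≤ ‖x n - w n - (x m - w m)‖ + ‖w n - w m‖ := norm_add_le _ _
      _ < δ := by linarith
  have h3 := huc h2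
  rw [dist_eq_norm] at h3
  calc ‖h (x n)‖ ≤ ‖h (x m)‖ + ‖h (x n) - h (x m)‖ := norm_le_insert' _ _
    _ < 2 * ε := by linarith

/-- A bounded sequence with vanishing increments and finitely many cluster points converges. -/
lemma exists_tendsto_of_finite_mapClusterPt {X : Type*} [MetricSpace X] [ProperSpace X]
    {x : ℕ → X} (hb : Bornology.IsBounded (Set.range x))
    (hstep : Tendsto (fun n => dist (x (n + 1)) (x n)) atTop (𝓝 0))
    (hfin : {y | MapClusterPt y atTop x}.Finite) : ∃ y, Tendsto x atTop (𝓝 y) := by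
  obtain ⟨p, -, hp⟩ := hb.isCompact_closure.exists_mapClusterPt (f := atTop) (u := x)
    (tendsto_principal.2 (Eventually.of_forall fun n => subset_closure ⟨n, rfl⟩))
  refine ⟨p, Metric.tendsto_atTop.2 fun ε₀ hε₀ => ?_⟩
  -- Finiteness isolates `p` from the other cluster points.
  obtain ⟨r, hr, hrp⟩ : ∃ r > 0, ∀ y, MapClusterPt y atTop x → dist y p ≤ r → y = p := by
    have h1 : ({y | MapClusterPt y atTop x} \ {p})ᶜ ∈ 𝓝 p :=
      (hfin.subset Set.sdiff_subset).isClosed.isOpen_compl.mem_nhds (by simp)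
    obtain ⟨r, hr, hrs⟩ := Metric.nhds_basis_closedBall.mem_iff.1 h1
    refine ⟨r, hr, fun y hy hyr => ?_⟩
    by_contra hne
    exact hrs (Metric.mem_closedBall.2 hyr) ⟨hy, hne⟩
  set ε := min ε₀ r with hε
  have hε0 : 0 < ε := lt_min hε₀ hr
  have hcpt : IsCompact (Metric.closedBall p ε \ Metric.ball p (ε / 2)) :=
    (isCompact_closedBall p ε).diff Metric.isOpen_ball
  -- Infinitely many visits to this compact annulus would give a cluster point in it, necessarily
  -- different from `p`. Steps shorter than its width `ε / 2` cannot jump over it.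
  have hann : ∀ᶠ n in atTop, x n ∉ Metric.closedBall p ε \ Metric.ball p (ε / 2) := by
    by_contra hcon
    rw [not_eventually] at hcon
    simp only [not_not] at hcon
    obtain ⟨y, hy, hyc⟩ := hcpt.exists_mapClusterPt_of_frequently hcon
    have hyp := hrp y hyc ((Metric.mem_closedBall.1 hy.1).trans (min_le_right _ _))
    exact hy.2 (by rw [hyp]; exact Metric.mem_ball_self (by positivity))
  have hst : ∀ᶠ n in atTop, dist (x (n + 1)) (x n) < ε / 2 :=
    hstep.eventually_lt_const (by positivity)
  obtain ⟨T, hT⟩ := eventually_atTop.1 (hann.and hst)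
  have hfreq : ∃ᶠ n in atTop, x n ∈ Metric.ball p (ε / 2) :=
    hp.frequently (Metric.ball_mem_nhds p (by positivity))
  obtain ⟨n₀, hn₀, hxn₀⟩ := frequently_atTop.1 hfreq T
  have hall : ∀ n, n₀ ≤ n → dist (x n) p < ε / 2 := by
    intro n hn
    induction n, hn using Nat.le_induction with
    | base => exact hxn₀
    | succ n hn ih =>
      by_contra hcon
      have h1 := (hT n (by omega)).2
      have h2 := dist_triangle (x (n + 1)) (x n) p
      exact (hT (n + 1) (by omega)).1 ⟨Metric.mem_closedBall.2 (by linarith), hcon⟩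
  refine ⟨n₀, fun n hn => (hall n hn).trans_le ?_⟩
  have := min_le_left ε₀ r
  linarith

end Deterministic

/-! ### Freezing under independence, and martingale convergence. -/

section Probability

open scoped RealInnerProductSpace ENNReal

variable {Ω : Type*} {mΩ : MeasurableSpace Ω} {P : Measure Ω}

/-- Tonelli for the product law of `(Y, ξ)`: the value of `Y` may be frozen while `ξ` is averaged.
This replaces conditional expectations throughout. -/
lemma ProbabilityTheory.IndepFun.lintegral_prodMk [IsProbabilityMeasure P] {T S : Type*}
    [MeasurableSpace T] [MeasurableSpace S] {Y : Ω → T} {ξ : Ω → S} (h : IndepFun Y ξ P)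
    (hY : Measurable Y) (hξ : Measurable ξ) {φ : T × S → ℝ≥0∞} (hφ : Measurable φ) :
    ∫⁻ ω, φ (Y ω, ξ ω) ∂P = ∫⁻ ω, ∫⁻ ω', φ (Y ω, ξ ω') ∂P ∂P := by
  have hY' : IsProbabilityMeasure (P.map Y) := Measure.isProbabilityMeasure_map hY.aemeasurable
  have hξ' : IsProbabilityMeasure (P.map ξ) := Measure.isProbabilityMeasure_map hξ.aemeasurable
  rw [← lintegral_map hφ (hY.prodMk hξ),
    (indepFun_iff_map_prod_eq_prod_map_map hY.aemeasurable hξ.aemeasurable).1 h,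
    lintegral_prod _ hφ.aemeasurable, lintegral_map hφ.lintegral_prod_right' hY]
  refine lintegral_congr fun ω => ?_
  exact lintegral_map (hφ.comp measurable_prodMk_left) hξ

lemma ProbabilityTheory.IndepFun.integral_prodMk [IsProbabilityMeasure P] {T S : Type*}
    [MeasurableSpace T] [MeasurableSpace S] {Y : Ω → T} {ξ : Ω → S} (h : IndepFun Y ξ P)
    (hY : Measurable Y) (hξ : Measurable ξ) {φ : T × S → ℝ} (hφ : Measurable φ)
    (hint : Integrable (fun ω => φ (Y ω, ξ ω)) P) :
    ∫ ω, φ (Y ω, ξ ω) ∂P = ∫ ω, ∫ ω', φ (Y ω, ξ ω') ∂P ∂P := by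
  have hY' : IsProbabilityMeasure (P.map Y) := Measure.isProbabilityMeasure_map hY.aemeasurable
  have hξ' : IsProbabilityMeasure (P.map ξ) := Measure.isProbabilityMeasure_map hξ.aemeasurable
  have hmap := (indepFun_iff_map_prod_eq_prod_map_map hY.aemeasurable hξ.aemeasurable).1 h
  have hint' : Integrable φ ((P.map Y).prod (P.map ξ)) := by
    rw [← hmap, integrable_map_measure hφ.aestronglyMeasurable (hY.prodMk hξ).aemeasurable]
    exact hint
  rw [← integral_map (hY.prodMk hξ).aemeasurable hφ.aestronglyMeasurable, hmap,
    integral_prod _ hint', integral_map hY.aemeasurable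
      hφ.stronglyMeasurable.integral_prod_right'.aestronglyMeasurable]
  refine integral_congr_ae (Eventually.of_forall fun ω => ?_)
  exact integral_map hξ.aemeasurable (hφ.comp measurable_prodMk_left).aestronglyMeasurable

lemma MeasureTheory.MemLp.smul_of_abs_le {E : Type*} [NormedAddCommGroup E] [NormedSpace ℝ E]
    {B : ℝ} {φ : Ω → ℝ} {g : Ω → E} (hφm : Measurable φ) (hφ : ∀ ω, |φ ω| ≤ B)
    (hg : MemLp g 2 P) : MemLp (fun ω => φ ω • g ω) 2 P := by
  refine hg.of_le_mul (c := B) (hφm.aestronglyMeasurable.smul hg.1)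
    (Eventually.of_forall fun ω => ?_)
  rw [norm_smul]
  exact mul_le_mul_of_nonneg_right (hφ ω) (norm_nonneg _)

lemma MeasureTheory.Integrable.mul_of_nonneg_of_le {B : ℝ} {φ X : Ω → ℝ} (hφm : Measurable φ) (h0 : ∀ ω, 0 ≤ φ ω)
    (h1 : ∀ ω, φ ω ≤ B) (hX : Integrable X P) : Integrable (fun ω => φ ω * X ω) P :=
  hX.bdd_mul (c := B) hφm.aestronglyMeasurable
    (Eventually.of_forall fun ω => by rw [Real.norm_of_nonneg (h0 ω)]; exact h1 ω)

/-- A nonnegative supermartingale converges almost surely. -/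
lemma MeasureTheory.Supermartingale.exists_ae_tendsto_of_nonneg [IsFiniteMeasure P]
    {F : Filtration ℕ mΩ} {Y : ℕ → Ω → ℝ} (hY : Supermartingale Y F P)
    (h0 : ∀ n ω, 0 ≤ Y n ω) : ∀ᵐ ω ∂P, ∃ l, Tendsto (fun n => Y n ω) atTop (𝓝 l) := by
  have hb : ∀ n, eLpNorm ((-Y) n) 1 P ≤ ((∫ ω, Y 0 ω ∂P).toNNReal : ℝ≥0∞) := by
    intro n
    rw [Pi.neg_apply, eLpNorm_neg, eLpNorm_one_eq_lintegral_enorm,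
      ← ofReal_integral_norm_eq_lintegral_enorm (hY.integrable n)]
    refine ENNReal.ofReal_le_ofReal ?_
    have h1 := hY.setIntegral_le (Nat.zero_le n) MeasurableSet.univ
    rw [setIntegral_univ, setIntegral_univ] at h1
    refine le_trans (le_of_eq ?_) h1
    exact integral_congr_ae (Eventually.of_forall fun ω => Real.norm_of_nonneg (h0 n ω))
  filter_upwards [hY.neg.exists_ae_tendsto_of_bdd hb] with ω ⟨l, hl⟩
  exact ⟨-l, by simpa using hl.neg⟩

/-- The **Robbins–Siegmund theorem** for coefficients `a` with deterministically bounded sum. -/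
lemma robbins_siegmund [IsProbabilityMeasure P] {F : Filtration ℕ mΩ} {V D a : ℕ → Ω → ℝ}
    (hV : ∀ t, Measurable[F t] (V t)) (hD : ∀ t, Measurable[F t] (D t))
    (ha : ∀ t, Measurable[F t] (a t)) (hV0 : ∀ t ω, 0 ≤ V t ω) (hD0 : ∀ t ω, 0 ≤ D t ω)
    (ha0 : ∀ t ω, 0 ≤ a t ω) {M : ℝ} (haM : ∀ n ω, ∑ t ∈ Finset.range n, a t ω ≤ M)
    (hVi : ∀ t, Integrable (V t) P) (hDi : ∀ t, Integrable (D t) P)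
    (hstep : ∀ t (φ : Ω → ℝ), Measurable[F t] φ → (∀ ω, 0 ≤ φ ω) → (∀ ω, φ ω ≤ 1) →
      ∫ ω, φ ω * V (t + 1) ω ∂P ≤ ∫ ω, φ ω * ((1 + a t ω) * V t ω - D t ω) ∂P) :
    (∀ᵐ ω ∂P, ∃ l, Tendsto (fun t => V t ω) atTop (𝓝 l)) ∧
    (∀ᵐ ω ∂P, Summable fun t => D t ω) ∧
    ∃ R, ∀ n, ∫ ω, ∑ t ∈ Finset.range n, D t ω ∂P ≤ R := by
  -- The discount `w` cancels the growth factors, as `w (n + 1) * (1 + a n) = w n`. It is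
  -- predictable, and it stays above `exp (-M)`, so bounds on discounted quantities carry over to
  -- the original ones.
  set w : ℕ → Ω → ℝ := fun n ω => (∏ t ∈ Finset.range n, (1 + a t ω))⁻¹ with hw
  have hprod1 : ∀ n ω, 1 ≤ ∏ t ∈ Finset.range n, (1 + a t ω) := fun n ω =>
    Finset.one_le_prod fun t _ => by linarith [ha0 t ω]
  have hw0 : ∀ n ω, 0 < w n ω := fun n ω => inv_pos.2 (zero_lt_one.trans_le (hprod1 n ω))
  have hw1 : ∀ n ω, w n ω ≤ 1 := fun n ω => inv_le_one_of_one_le₀ (hprod1 n ω)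
  have hwM : ∀ n ω, Real.exp (-M) ≤ w n ω := by
    intro n ω
    rw [Real.exp_neg]
    refine inv_anti₀ (zero_lt_one.trans_le (hprod1 n ω)) ?_
    calc ∏ t ∈ Finset.range n, (1 + a t ω) ≤ ∏ t ∈ Finset.range n, Real.exp (a t ω) := by
          refine Finset.prod_le_prod (fun t _ => by linarith [ha0 t ω]) fun t _ => ?_
          rw [add_comm]; exact Real.add_one_le_exp _
      _ = Real.exp (∑ t ∈ Finset.range n, a t ω) := (Real.exp_sum _ _).symm
      _ ≤ Real.exp M := Real.exp_le_exp.2 (haM n ω)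
  have hwsucc : ∀ n ω, w (n + 1) ω * (1 + a n ω) = w n ω := by
    intro n ω
    have h1 : 1 + a n ω ≠ 0 := by linarith [ha0 n ω]
    simp only [hw, Finset.prod_range_succ, mul_inv]
    field_simp
  have hwm : ∀ n, Measurable[F n] (w (n + 1)) := by
    intro n
    refine Measurable.inv (Finset.measurable_fun_prod _ fun t ht => ?_)
    exact measurable_const.add
      ((ha t).mono (F.mono (Nat.lt_succ_iff.1 (Finset.mem_range.1 ht))) le_rfl)
  have hwm' : ∀ n, Measurable[F n] (w n) := by
    intro n
    cases n with
    | zero => simp only [hw, Finset.range_zero, Finset.prod_empty]; exact measurable_const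
    | succ n => exact (hwm n).mono (F.mono (Nat.le_succ n)) le_rfl
  set Q : ℕ → Ω → ℝ := fun n ω => ∑ t ∈ Finset.range n, w (t + 1) ω * D t ω with hQ
  set Y : ℕ → Ω → ℝ := fun n ω => w n ω * V n ω + Q n ω with hYdef
  have hmul : ∀ {φ X : Ω → ℝ}, Measurable φ → (∀ ω, 0 ≤ φ ω) → (∀ ω, φ ω ≤ 1) → Integrable X P →
      Integrable (fun ω => φ ω * X ω) P := fun hφ h0 h1 hX =>
    hX.bdd_mul (c := 1) hφ.aestronglyMeasurable
      (Eventually.of_forall fun ω => by rw [Real.norm_of_nonneg (h0 ω)]; exact h1 ω)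
  have hQi : ∀ n, Integrable (Q n) P := fun n => integrable_finsetSum _ fun t _ =>
    hmul ((hwm t).mono (F.le t) le_rfl) (fun ω => (hw0 _ ω).le) (hw1 _) (hDi t)
  have hwVi : ∀ n, Integrable (fun ω => w n ω * V n ω) P := fun n =>
    hmul ((hwm' n).mono (F.le n) le_rfl) (fun ω => (hw0 _ ω).le) (hw1 _) (hVi n)
  have hYi : ∀ n, Integrable (Y n) P := fun n => (hwVi n).add (hQi n)
  have hQm : ∀ n, Measurable[F n] (Q n) := fun n => Finset.measurable_fun_sum _ fun t ht =>
    ((hwm t).mul (hD t)).mono (F.mono (Finset.mem_range.1 ht).le) le_rfl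
  have hQ0 : ∀ n ω, 0 ≤ Q n ω := fun n ω =>
    Finset.sum_nonneg fun t _ => mul_nonneg (hw0 _ ω).le (hD0 t ω)
  have hY0 : ∀ n ω, 0 ≤ Y n ω := fun n ω =>
    add_nonneg (mul_nonneg (hw0 n ω).le (hV0 n ω)) (hQ0 n ω)
  have hsuper : Supermartingale Y F P := by
    refine supermartingale_of_setIntegral_succ_le
      (fun n => (((hwm' n).mul (hV n)).add (hQm n)).stronglyMeasurable) hYi fun n s hs => ?_
    have hs' := F.le n s hs
    -- The hypothesis `hstep` is a conditional expectation inequality in weak form; this test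
    -- function extracts the supermartingale inequality on `s`.
    have hst := hstep n (s.indicator (w (n + 1))) ((hwm n).indicator hs)
      (fun ω => Set.indicator_nonneg (fun ω _ => (hw0 _ ω).le) ω)
      (fun ω => Set.indicator_le_self' (fun ω _ => (hw0 _ ω).le) ω |>.trans (hw1 _ ω))
    have e1 : ∀ X : Ω → ℝ, ∫ ω, s.indicator (w (n + 1)) ω * X ω ∂P
        = ∫ ω in s, w (n + 1) ω * X ω ∂P := fun X => by
      rw [← integral_indicator hs']
      refine integral_congr_ae (Eventually.of_forall fun ω => ?_)
      by_cases hω : ω ∈ s <;> simp [hω]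
    rw [e1, e1] at hst
    have hwDi : Integrable (fun ω => w (n + 1) ω * D n ω) P :=
      hmul ((hwm n).mono (F.le n) le_rfl) (fun ω => (hw0 _ ω).le) (hw1 _) (hDi n)
    have e2 : ∫ ω in s, w (n + 1) ω * ((1 + a n ω) * V n ω - D n ω) ∂P
        = ∫ ω in s, w n ω * V n ω ∂P - ∫ ω in s, w (n + 1) ω * D n ω ∂P := by
      rw [← integral_sub (hwVi n).integrableOn hwDi.integrableOn]
      refine integral_congr_ae (Eventually.of_forall fun ω => ?_)
      simp only [← hwsucc n ω]; ring
    rw [e2] at hst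
    have hQD : Integrable (fun ω => Q n ω + w (n + 1) ω * D n ω) P := (hQi n).add hwDi
    have e3 : ∫ ω in s, Y (n + 1) ω ∂P = ∫ ω in s, w (n + 1) ω * V (n + 1) ω ∂P
        + (∫ ω in s, Q n ω ∂P + ∫ ω in s, w (n + 1) ω * D n ω ∂P) := by
      rw [← integral_add (hQi n).integrableOn hwDi.integrableOn, ← integral_add
        (hwVi (n + 1)).integrableOn hQD.integrableOn]
      refine integral_congr_ae (Eventually.of_forall fun ω => ?_)
      simp only [hYdef, hQ, Finset.sum_range_succ]
    have e4 : ∫ ω in s, Y n ω ∂P = ∫ ω in s, w n ω * V n ω ∂P + ∫ ω in s, Q n ω ∂P := by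
      rw [← integral_add (hwVi n).integrableOn (hQi n).integrableOn]
    rw [e3, e4]
    linarith
  have hDQ : ∀ n ω, ∑ t ∈ Finset.range n, D t ω ≤ Real.exp M * Q n ω := by
    intro n ω
    rw [hQ, Finset.mul_sum]
    refine Finset.sum_le_sum fun t _ => ?_
    have h1 : 1 ≤ Real.exp M * w (t + 1) ω := by
      calc (1 : ℝ) = Real.exp M * Real.exp (-M) := by rw [← Real.exp_add]; simp
        _ ≤ _ := by gcongr; exact hwM _ _
    nlinarith [hD0 t ω]
  have hae : ∀ᵐ ω ∂P, (∃ l, Tendsto (fun t => V t ω) atTop (𝓝 l)) ∧ Summable fun t => D t ω := by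
    filter_upwards [hsuper.exists_ae_tendsto_of_nonneg hY0] with ω ⟨l, hl⟩
    obtain ⟨B, hB⟩ := hl.bddAbove_range
    have hQB : ∀ n, Q n ω ≤ B := fun n => by
      have h1 : Y n ω ≤ B := hB ⟨n, rfl⟩
      have h2 := mul_nonneg (hw0 n ω).le (hV0 n ω)
      simp only [hYdef] at h1
      linarith
    have hQsum : Summable fun t => w (t + 1) ω * D t ω :=
      summable_of_sum_range_le (fun t => mul_nonneg (hw0 _ ω).le (hD0 t ω)) hQB
    have hwanti : Antitone fun n => w n ω := antitone_nat_of_succ_le fun n => by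
      rw [← hwsucc n ω]
      exact le_mul_of_one_le_right (hw0 _ ω).le (by linarith [ha0 n ω])
    have hwlim := tendsto_atTop_ciInf hwanti ⟨Real.exp (-M), by rintro _ ⟨n, rfl⟩; exact hwM n ω⟩
    have hwne : (⨅ n, w n ω) ≠ 0 :=
      ((Real.exp_pos _).trans_le (le_ciInf fun n => hwM n ω)).ne'
    refine ⟨⟨_, (((hl.sub hQsum.hasSum.tendsto_sum_nat).div hwlim hwne).congr fun n => ?_)⟩, ?_⟩
    · have := (hw0 n ω).ne'
      simp only [hYdef, hQ, Pi.div_apply]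
      field_simp
      ring
    · refine summable_of_sum_range_le (fun t => hD0 t ω) (c := Real.exp M * B) fun n =>
        (hDQ n ω).trans ?_
      gcongr
      exact hQB n
  refine ⟨hae.mono fun ω h => h.1, hae.mono fun ω h => h.2, Real.exp M * ∫ ω, Y 0 ω ∂P, fun n => ?_⟩
  calc ∫ ω, ∑ t ∈ Finset.range n, D t ω ∂P ≤ ∫ ω, Real.exp M * Y n ω ∂P := by
        refine integral_mono (integrable_finsetSum _ fun t _ => hDi t) ((hYi n).const_mul _)
          fun ω => (hDQ n ω).trans ?_
        have := mul_nonneg (hw0 n ω).le (hV0 n ω)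
        simp only [hYdef]
        gcongr
        linarith
    _ = Real.exp M * ∫ ω, Y n ω ∂P := integral_const_mul _ _
    _ ≤ _ := by
        have h1 := hsuper.setIntegral_le (Nat.zero_le n) MeasurableSet.univ
        rw [setIntegral_univ, setIntegral_univ] at h1
        gcongr

/-- A martingale bounded in `L²` converges almost surely. -/
lemma MeasureTheory.Martingale.exists_ae_tendsto_of_sq_le [IsProbabilityMeasure P]
    {F : Filtration ℕ mΩ} {Y : ℕ → Ω → ℝ} (hY : Martingale Y F P)
    (hsq : ∀ n, Integrable (fun ω => Y n ω ^ 2) P) {B : ℝ} (hB : ∀ n, ∫ ω, Y n ω ^ 2 ∂P ≤ B) :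
    ∀ᵐ ω ∂P, ∃ l, Tendsto (fun n => Y n ω) atTop (𝓝 l) := by
  refine hY.submartingale.exists_ae_tendsto_of_bdd (R := (1 + B).toNNReal) fun n => ?_
  rw [eLpNorm_one_eq_lintegral_enorm,
    ← ofReal_integral_norm_eq_lintegral_enorm (hY.integrable n)]
  refine ENNReal.ofReal_le_ofReal ?_
  calc ∫ ω, ‖Y n ω‖ ∂P ≤ ∫ ω, (1 + Y n ω ^ 2) ∂P := by
        refine integral_mono (hY.integrable n).norm ((integrable_const _).add (hsq n)) fun ω => ?_
        rw [← sq_abs, Real.norm_eq_abs]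
        nlinarith [sq_nonneg (|Y n ω| - 1), abs_nonneg (Y n ω)]
    _ = 1 + ∫ ω, Y n ω ^ 2 ∂P := by
        rw [integral_add (integrable_const _) (hsq n)]; simp
    _ ≤ _ := by linarith [hB n]

end Probability

/-! ### Convergence along a single path. -/

section Momentum

set_option linter.unusedSectionVars false

open scoped RealInnerProductSpace ENNReal

variable {E : Type*} [NormedAddCommGroup E] [InnerProductSpace ℝ E] [CompleteSpace E]

lemma HolderGradient.tendsto_of_path {f : E → ℝ} {α A : ℝ} (h : HolderGradient f α A)
    {γ : ℕ → ℝ} {x z v N : ℕ → E} {β b : ℝ} (hβ1 : β < 1) (hγ : ∀ t, 0 ≤ γ t)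
    (hγ0 : Tendsto γ atTop (𝓝 0))
    (hdiv : Tendsto (fun n => ∑ t ∈ Finset.range n, γ t) atTop atTop)
    (hz : ∀ t, z (t + 1) = z t - (γ t / (1 - β)) • (gradient f (x t) + N t))
    (hx : ∀ t, x t = z t - b • v t) (hv : Tendsto v atTop (𝓝 0)) {l : ℝ}
    (hfz : Tendsto (fun t => f (z t)) atTop (𝓝 l)) {e : E}
    (hS : Tendsto (fun n => ∑ t ∈ Finset.range n, γ t • N t) atTop (𝓝 e))
    (hsum : Summable fun t => γ t * ‖gradient f (x t)‖ ^ 2) :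
    Tendsto (fun t => f (x t)) atTop (𝓝 l) ∧
    Tendsto (fun t => gradient f (x t)) atTop (𝓝 0) ∧
    Tendsto (fun t => dist (x (t + 1)) (x t)) atTop (𝓝 0) := by
  have hβ' : 0 < 1 - β := by linarith
  -- Adding back the noise turns `z` into exact gradient steps; `x - w` converges because `v → 0`
  -- and the noise sums converge.
  set w : ℕ → E := fun n => z n + (1 / (1 - β)) • ∑ t ∈ Finset.range n, γ t • N t with hw
  have hwsucc : ∀ n, w (n + 1) = w n - (γ n / (1 - β)) • gradient f (x n) := by
    intro n
    simp only [hw, hz, Finset.sum_range_succ]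
    rw [show γ n / (1 - β) = 1 / (1 - β) * γ n by ring]
    module
  have hxw : Tendsto (fun n => x n - w n) atTop (𝓝 (-(b • (0 : E)) - (1 / (1 - β)) • e)) := by
    refine (((hv.const_smul b).neg).sub (hS.const_smul (1 / (1 - β)))).congr fun n => ?_
    simp only [hw, hx]
    abel
  have hη0 : Tendsto (fun n => γ n / (1 - β)) atTop (𝓝 0) := by
    simpa using hγ0.div_const (1 - β)
  have hgrad : Tendsto (fun t => gradient f (x t)) atTop (𝓝 0) := by
    refine tendsto_zero_of_summable_mul_sq h.uniformContinuous
      (fun n => div_nonneg (hγ n) hβ'.le) hη0 ?_ hwsucc hxw ?_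
    · simp_rw [← Finset.sum_div]
      exact hdiv.atTop_div_const hβ'
    · exact (hsum.div_const (1 - β)).congr fun n => by ring
  have hzx : Tendsto (fun n => z n - x n) atTop (𝓝 0) := by
    have := hv.const_smul b
    rw [smul_zero] at this
    exact this.congr fun n => by rw [hx]; abel
  refine ⟨?_, hgrad, ?_⟩
  · have h1 : Tendsto (fun n => f (z n) - f (x n) - ⟪gradient f (x n), z n - x n⟫) atTop (𝓝 0) := by
      have h2 : Tendsto (fun n => A * ‖z n - x n‖ ^ (1 + α)) atTop (𝓝 0) := by
        have h3 := (hzx.norm.rpow_const (p := 1 + α) (Or.inr (by linarith [h.pos]))).const_mul A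
        rwa [norm_zero, Real.zero_rpow (by linarith [h.pos]), mul_zero] at h3
      exact squeeze_zero_norm (fun n => h.abs_sub_sub_inner_le (x n) (z n)) h2
    have h4 := (hfz.sub h1).sub (hgrad.inner hzx)
    simp only [inner_zero_left, sub_zero] at h4
    exact h4.congr fun n => by ring
  · have h1 := (((tendsto_add_atTop_iff_nat 1).2 hxw).sub hxw).sub (hη0.smul hgrad)
    rw [sub_self, smul_zero, sub_zero] at h1
    have h2 := h1.norm
    rw [norm_zero] at h2
    refine h2.congr fun n => ?_
    rw [dist_eq_norm, hwsucc]
    congr 1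
    abel

lemma exists_tendsto_of_finite_critical [ProperSpace E] {f : E → ℝ} (hf : Continuous f)
    (hf' : Continuous (gradient f))
    (hfin : ∀ a b : ℝ, a < b → {x | gradient f x = 0 ∧ a ≤ f x ∧ f x ≤ b}.Finite)
    (hcoer : Tendsto f (Bornology.cobounded E) atTop) {x : ℕ → E} {l : ℝ}
    (hfx : Tendsto (fun t => f (x t)) atTop (𝓝 l))
    (hgrad : Tendsto (fun t => gradient f (x t)) atTop (𝓝 0))
    (hstep : Tendsto (fun t => dist (x (t + 1)) (x t)) atTop (𝓝 0)) :
    ∃ y, Tendsto x atTop (𝓝 y) := by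
  refine exists_tendsto_of_finite_mapClusterPt ?_ hstep ?_
  · obtain ⟨B, hB⟩ := hfx.bddAbove_range
    have h1 : Bornology.IsBounded {y | B < f y}ᶜ :=
      Bornology.isBounded_def.2 (by rw [compl_compl]; exact hcoer.eventually_gt_atTop B)
    refine h1.subset ?_
    rintro _ ⟨n, rfl⟩
    exact not_lt.2 (hB ⟨n, rfl⟩)
  · refine (hfin (l - 1) (l + 1) (by linarith)).subset fun y hy => ?_
    obtain ⟨U, hU, hUy⟩ := mapClusterPt_iff_ultrafilter.1 hy
    have h1 : gradient f y = 0 :=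
      tendsto_nhds_unique ((hf'.tendsto y).comp hUy) (hgrad.mono_left hU)
    have h2 : f y = l := tendsto_nhds_unique ((hf.tendsto y).comp hUy) (hfx.mono_left hU)
    exact ⟨h1, by linarith, by linarith⟩

/-! ### Momentum processes: adaptedness and integrability. -/

variable {Ω : Type*} {mΩ : MeasurableSpace Ω} [MeasurableSpace E] [BorelSpace E]
  [SecondCountableTopology E]

/-- A stochastic momentum method for `f`, in the coordinates in which `z` performs plain stochastic
gradient steps and `v` is the momentum buffer; the stepsizes are adapted and `∑ γ ^ (1 + α)` has a
deterministic bound, and the noise `N` is centered with variance at most `σ² + C ‖∇f(x)‖²` given the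
past. -/
structure IsMomentumProcess (P : Measure Ω) (F : Filtration ℕ mΩ) (f : E → ℝ)
    (α β c σ C M : ℝ) (z₀ : E) (γ : ℕ → Ω → ℝ) (x z v N : ℕ → Ω → E) : Prop where
  measurable_step : ∀ t, Measurable[F t] (γ t)
  step_nonneg : ∀ t ω, 0 ≤ γ t ω
  step_sum_le : ∀ n ω, ∑ t ∈ Finset.range n, γ t ω ^ (1 + α) ≤ M
  measurable_noise : ∀ t, Measurable[F (t + 1)] (N t)
  z_zero : ∀ ω, z 0 ω = z₀
  v_zero : ∀ ω, v 0 ω = 0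
  z_succ : ∀ t ω, z (t + 1) ω = z t ω - (γ t ω / (1 - β)) • (gradient f (x t ω) + N t ω)
  v_succ : ∀ t ω, v (t + 1) ω = β • v t ω - (c * γ t ω) • (gradient f (x t ω) + N t ω)
  x_eq : ∀ t ω, x t ω = z t ω - (β / (1 - β)) • v t ω
  lintegral_noise_le : ∀ t (q : Ω → ℝ≥0∞), Measurable[F t] q →
    ∫⁻ ω, q ω * ‖N t ω‖ₑ ^ 2 ∂P
      ≤ ∫⁻ ω, q ω * ENNReal.ofReal (σ ^ 2 + C * ‖gradient f (x t ω)‖ ^ 2) ∂P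
  integral_noise_eq : ∀ t (u : Ω → E), Measurable[F t] u →
    Integrable (fun ω => ⟪u ω, N t ω⟫) P → ∫ ω, ⟪u ω, N t ω⟫ ∂P = 0

namespace IsMomentumProcess

variable {P : Measure Ω} [IsProbabilityMeasure P] {F : Filtration ℕ mΩ} {f : E → ℝ}
  {α A β c σ C M : ℝ} {z₀ : E} {γ : ℕ → Ω → ℝ} {x z v N : ℕ → Ω → E}

lemma bound_nonneg (hp : IsMomentumProcess P F f α β c σ C M z₀ γ x z v N) : 0 ≤ M := by
  obtain ⟨ω⟩ : Nonempty Ω := P.nonempty_of_neZero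
  simpa using hp.step_sum_le 0 ω

lemma rpow_step_le (hp : IsMomentumProcess P F f α β c σ C M z₀ γ x z v N) (t : ℕ) (ω : Ω) :
    γ t ω ^ (1 + α) ≤ M :=
  (Finset.single_le_sum (f := fun t => γ t ω ^ (1 + α))
    (fun t _ => Real.rpow_nonneg (hp.step_nonneg t ω) _)
    (Finset.self_mem_range_succ t)).trans (hp.step_sum_le (t + 1) ω)

lemma step_le (hp : IsMomentumProcess P F f α β c σ C M z₀ γ x z v N) (hα : 0 < α)
    (t : ℕ) (ω : Ω) : γ t ω ≤ 1 + M := by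
  rcases le_total (γ t ω) 1 with h | h
  · linarith [hp.bound_nonneg]
  · have h1 := Real.rpow_le_rpow_of_exponent_le h (show 1 ≤ 1 + α by linarith)
    rw [Real.rpow_one] at h1
    linarith [hp.rpow_step_le t ω]

/-- The variance of `∑ γ N` involves `γ²`, whereas only `γ^(1+α)` is summable. The quotient
`γ^(1-α)` is bounded because the stepsizes are. -/
lemma sq_step_le (hp : IsMomentumProcess P F f α β c σ C M z₀ γ x z v N) (hα : 0 < α)
    (hα1 : α ≤ 1) (t : ℕ) (ω : Ω) : γ t ω ^ 2 ≤ (1 + M) * γ t ω ^ (1 + α) := by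
  have h0 := hp.step_nonneg t ω
  have hM := hp.bound_nonneg
  have h1 : γ t ω ^ (1 - α) ≤ 1 + M := by
    rcases le_total (γ t ω) 1 with h | h
    · linarith [Real.rpow_le_one h0 h (show 0 ≤ 1 - α by linarith)]
    · have h1 := Real.rpow_le_rpow_of_exponent_le h (show 1 - α ≤ 1 by linarith)
      rw [Real.rpow_one] at h1
      linarith [hp.step_le hα t ω]
  calc γ t ω ^ 2 = γ t ω ^ (1 - α) * γ t ω ^ (1 + α) := by
        rw [← Real.rpow_add_of_nonneg h0 (by linarith) (by linarith), ← Real.rpow_two]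
        congr 1; ring
    _ ≤ _ := by gcongr

lemma measurable_z_v (hp : IsMomentumProcess P F f α β c σ C M z₀ γ x z v N)
    (hf' : Continuous (gradient f)) (t : ℕ) : Measurable[F t] (z t) ∧ Measurable[F t] (v t) := by
  induction t with
  | zero =>
    rw [funext hp.z_zero, funext hp.v_zero]
    exact ⟨measurable_const, measurable_const⟩
  | succ t ih =>
    have hm := F.mono (Nat.le_succ t)
    have hz := ih.1.mono hm le_rfl
    have hv := ih.2.mono hm le_rfl
    have hγ := (hp.measurable_step t).mono hm le_rfl
    have hx : Measurable[F (t + 1)] (x t) := by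
      rw [funext (hp.x_eq t)]
      exact hz.sub (hv.const_smul _)
    have hg := (hf'.measurable.comp hx).add (hp.measurable_noise t)
    rw [funext (hp.z_succ t), funext (hp.v_succ t)]
    exact ⟨hz.sub ((hγ.div_const _).smul hg), (hv.const_smul β).sub ((hγ.const_mul c).smul hg)⟩

lemma measurable_x (hp : IsMomentumProcess P F f α β c σ C M z₀ γ x z v N)
    (hf' : Continuous (gradient f)) (t : ℕ) : Measurable[F t] (x t) := by
  rw [funext (hp.x_eq t)]
  exact (hp.measurable_z_v hf' t).1.sub ((hp.measurable_z_v hf' t).2.const_smul _)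

lemma measurable_gradient (hp : IsMomentumProcess P F f α β c σ C M z₀ γ x z v N)
    (hf' : Continuous (gradient f)) (t : ℕ) : Measurable[F t] fun ω => gradient f (x t ω) :=
  hf'.measurable.comp (hp.measurable_x hf' t)

lemma memLp_gradient (h : HolderGradient f α A) {y : Ω → E} (hy : MemLp y 2 P) :
    MemLp (fun ω => gradient f (y ω)) 2 P := by
  have h0 : MemLp (fun ω => 1 + ‖y ω‖) 2 P := MemLp.add (memLp_const (1 : ℝ)) hy.norm
  have h1 : MemLp (fun ω => ‖gradient f 0‖ + A * (1 + ‖y ω‖)) 2 P :=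
    MemLp.add (memLp_const ‖gradient f 0‖) (h0.const_mul A)
  refine h1.mono (h.uniformContinuous.continuous.comp_aestronglyMeasurable hy.1)
    (Eventually.of_forall fun ω => (h.norm_gradient_le (y ω)).trans (le_abs_self _))

lemma memLp_noise (hp : IsMomentumProcess P F f α β c σ C M z₀ γ x z v N)
    {t : ℕ} (hg : MemLp (fun ω => gradient f (x t ω)) 2 P) : MemLp (N t) 2 P := by
  have hm : AEStronglyMeasurable (N t) P :=
    ((hp.measurable_noise t).mono (F.le _) le_rfl).aestronglyMeasurable
  rw [memLp_two_iff_integrable_sq_norm hm]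
  have h1 := hp.lintegral_noise_le t (fun _ => 1) measurable_const
  simp only [one_mul] at h1
  refine ⟨hm.norm.pow 2, ?_⟩
  have h2 : Integrable (fun ω => σ ^ 2 + C * ‖gradient f (x t ω)‖ ^ 2) P :=
    (integrable_const _).add (hg.norm.integrable_sq.const_mul C)
  refine lt_of_le_of_lt ?_ (lt_of_le_of_lt h1 ?_)
  · refine lintegral_mono fun ω => ?_
    simp [enorm_pow]
  · have h3 := h2.2
    refine lt_of_le_of_lt (lintegral_mono fun ω => ?_) h3
    rw [Real.enorm_eq_ofReal_abs]
    exact ENNReal.ofReal_le_ofReal (le_abs_self _)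

/-- Square integrability passes from `x t` to its gradient by linear growth, then to the noise by
the variance bound, then to the next state because the stepsizes are bounded. -/
lemma memLp_z_v (hp : IsMomentumProcess P F f α β c σ C M z₀ γ x z v N)
    (h : HolderGradient f α A) (t : ℕ) : MemLp (z t) 2 P ∧ MemLp (v t) 2 P := by
  induction t with
  | zero =>
    rw [funext hp.z_zero, funext hp.v_zero]
    exact ⟨memLp_const _, memLp_const _⟩
  | succ t ih =>
    have hx : MemLp (x t) 2 P := by
      rw [funext (hp.x_eq t)]
      exact ih.1.sub (ih.2.const_smul _)
    have hg := memLp_gradient h hx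
    have hq := hg.add (hp.memLp_noise hg)
    have hγ : Measurable (γ t) := (hp.measurable_step t).mono (F.le t) le_rfl
    have hs := MemLp.smul_of_abs_le (B := 1 + M) hγ (fun ω => by
      rw [abs_of_nonneg (hp.step_nonneg t ω)]; exact hp.step_le h.pos t ω) hq
    refine ⟨?_, ?_⟩
    · refine (ih.1.sub (hs.const_smul (1 / (1 - β)))).congr_norm ?_ ?_
      · exact ((hp.measurable_z_v h.uniformContinuous.continuous (t + 1)).1.mono
          (F.le _) le_rfl).aestronglyMeasurable
      · refine Eventually.of_forall fun ω => ?_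
        rw [hp.z_succ]
        simp only [Pi.sub_apply, Pi.smul_apply, Pi.add_apply, smul_smul]
        congr 3
        ring
    · refine ((ih.2.const_smul β).sub (hs.const_smul c)).congr_norm ?_ ?_
      · exact ((hp.measurable_z_v h.uniformContinuous.continuous (t + 1)).2.mono
          (F.le _) le_rfl).aestronglyMeasurable
      · refine Eventually.of_forall fun ω => ?_
        rw [hp.v_succ]
        simp only [Pi.sub_apply, Pi.smul_apply, Pi.add_apply, smul_smul]

lemma memLp_gradient_x (hp : IsMomentumProcess P F f α β c σ C M z₀ γ x z v N)
    (h : HolderGradient f α A) (t : ℕ) :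
    MemLp (fun ω => gradient f (x t ω)) 2 P := by
  refine memLp_gradient h ?_
  rw [funext (hp.x_eq t)]
  exact (hp.memLp_z_v h t).1.sub ((hp.memLp_z_v h t).2.const_smul _)

lemma memLp_N (hp : IsMomentumProcess P F f α β c σ C M z₀ γ x z v N)
    (h : HolderGradient f α A) (t : ℕ) : MemLp (N t) 2 P :=
  hp.memLp_noise (hp.memLp_gradient_x h t)

lemma integral_mul_sq_noise_le (hp : IsMomentumProcess P F f α β c σ C M z₀ γ x z v N)
    (h : HolderGradient f α A) (hC : 0 ≤ C) {t : ℕ} {φ : Ω → ℝ} (hφm : Measurable[F t] φ)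
    (h0 : ∀ ω, 0 ≤ φ ω) {B : ℝ} (h1 : ∀ ω, φ ω ≤ B) :
    ∫ ω, φ ω * ‖N t ω‖ ^ 2 ∂P ≤ ∫ ω, φ ω * (σ ^ 2 + C * ‖gradient f (x t ω)‖ ^ 2) ∂P := by
  have hφm' : Measurable φ := hφm.mono (F.le t) le_rfl
  have hi1 := Integrable.mul_of_nonneg_of_le hφm' h0 h1 (hp.memLp_N h t).norm.integrable_sq
  have hi2 := Integrable.mul_of_nonneg_of_le hφm' h0 h1 (X := fun ω => σ ^ 2 + C * ‖gradient f (x t ω)‖ ^ 2)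
    ((integrable_const _).add ((hp.memLp_gradient_x h t).norm.integrable_sq.const_mul C))
  have hn1 : ∀ ω, 0 ≤ φ ω * ‖N t ω‖ ^ 2 := fun ω => mul_nonneg (h0 ω) (by positivity)
  have hn2 : ∀ ω, 0 ≤ φ ω * (σ ^ 2 + C * ‖gradient f (x t ω)‖ ^ 2) :=
    fun ω => mul_nonneg (h0 ω) (by positivity)
  rw [← ENNReal.ofReal_le_ofReal_iff (integral_nonneg hn2),
    ofReal_integral_eq_lintegral_ofReal hi1 (Eventually.of_forall hn1),
    ofReal_integral_eq_lintegral_ofReal hi2 (Eventually.of_forall hn2)]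
  have key := hp.lintegral_noise_le t (fun ω => ENNReal.ofReal (φ ω)) hφm.ennreal_ofReal
  refine (le_of_eq ?_).trans (key.trans (le_of_eq ?_))
  · refine lintegral_congr fun ω => ?_
    rw [ENNReal.ofReal_mul (h0 ω), ENNReal.ofReal_pow (norm_nonneg _), ofReal_norm]
  · refine lintegral_congr fun ω => ?_
    rw [ENNReal.ofReal_mul (h0 ω)]

end IsMomentumProcess

end Momentum

/-! ### Almost sure convergence of momentum processes. -/

section Convergence

set_option linter.unusedSectionVars false

open scoped RealInnerProductSpace ENNReal

variable {E : Type*} [NormedAddCommGroup E] [InnerProductSpace ℝ E] [CompleteSpace E]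
variable {Ω : Type*} {mΩ : MeasurableSpace Ω} [MeasurableSpace E] [BorelSpace E]
  [SecondCountableTopology E]

variable {P : Measure Ω} [IsProbabilityMeasure P] {F : Filtration ℕ mΩ} {f : E → ℝ}
  {α A β c σ C M : ℝ} {z₀ : E} {γ : ℕ → Ω → ℝ} {x z v N : ℕ → Ω → E}

lemma MeasureTheory.MemLp.integrable_real_inner {X Y : Ω → E} (hX : MemLp X 2 P)
    (hY : MemLp Y 2 P) : Integrable (fun ω => ⟪X ω, Y ω⟫) P :=
  (hX.norm.integrable_mul hY.norm).mono' (hX.1.inner hY.1)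
    (Eventually.of_forall fun _ => norm_inner_le_norm _ _)

namespace IsMomentumProcess

lemma integrable_objective (hp : IsMomentumProcess P F f α β c σ C M z₀ γ x z v N)
    (h : HolderGradient f α A) (t : ℕ) : Integrable (fun ω => f (z t ω)) P := by
  have h1 : Integrable (fun ω => |f 0| + (‖gradient f 0‖ + A) * (1 + ‖z t ω‖ ^ 2)) P :=
    Integrable.add (integrable_const _) (Integrable.const_mul
      (Integrable.add (integrable_const _) (hp.memLp_z_v h t).1.norm.integrable_sq) _)
  exact h1.mono' (h.differentiable.continuous.comp_aestronglyMeasurable (hp.memLp_z_v h t).1.1)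
    (Eventually.of_forall fun ω => h.abs_le_quadratic _)

lemma integrable_rpow_norm_v (hp : IsMomentumProcess P F f α β c σ C M z₀ γ x z v N)
    (h : HolderGradient f α A) (t : ℕ) : Integrable (fun ω => ‖v t ω‖ ^ (1 + α)) P := by
  have hv := (hp.memLp_z_v h t).2
  have h1 : Integrable (fun ω => 1 + ‖v t ω‖ ^ 2) P :=
    Integrable.add (integrable_const _) hv.norm.integrable_sq
  refine h1.mono' (hv.1.norm.aemeasurable.pow_const _).aestronglyMeasurable
    (Eventually.of_forall fun ω => ?_)
  rw [Real.norm_of_nonneg (by positivity)]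
  exact Real.rpow_le_one_add_sq (by linarith [h.pos]) (by linarith [h.le_one]) (norm_nonneg _)

lemma integrable_step_mul_sq (hp : IsMomentumProcess P F f α β c σ C M z₀ γ x z v N)
    (h : HolderGradient f α A) (t : ℕ) :
    Integrable (fun ω => γ t ω * ‖gradient f (x t ω)‖ ^ 2) P :=
  Integrable.mul_of_nonneg_of_le ((hp.measurable_step t).mono (F.le t) le_rfl) (hp.step_nonneg t)
    (hp.step_le h.pos t) (hp.memLp_gradient_x h t).norm.integrable_sq

/-- The almost sure consequences of the Lyapunov inequality. -/
lemma ae_lyapunov (hp : IsMomentumProcess P F f α β c σ C M z₀ γ x z v N)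
    (h : HolderGradient f α A) {m : ℝ} (hm : ∀ y, m ≤ f y) (hC : 0 ≤ C)
    (hβ : 0 ≤ β) (hβ1 : β < 1) :
    (∀ᵐ ω ∂P, (∃ l, Tendsto (fun t => f (z t ω)) atTop (𝓝 l)) ∧
      Tendsto (fun t => v t ω) atTop (𝓝 0) ∧
      Summable fun t => γ t ω * ‖gradient f (x t ω)‖ ^ 2) ∧
    ∃ R, ∀ n, ∫ ω, ∑ t ∈ Finset.range n, γ t ω * ‖gradient f (x t ω)‖ ^ 2 ∂P ≤ R := by
  have hcont := h.uniformContinuous.continuous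
  have hα := h.pos
  obtain ⟨K, κ, hK, hκ, hstep⟩ := h.exists_lyapunov_step hβ hβ1 c
  obtain ⟨c₂, hc₂, hgrad⟩ := h.exists_sq_norm_gradient_sub_le hm
    (div_nonneg hβ (by linarith : 0 ≤ 1 - β))
  have hK0 : 0 ≤ K := by linarith
  -- The summand `1` gives `V ≥ 1`, so that constant error terms are also multiples of `V`.
  set V : ℕ → Ω → ℝ := fun t ω => 1 + (f (z t ω) - m) + K * ‖v t ω‖ ^ (1 + α) with hV
  set D : ℕ → Ω → ℝ := fun t ω => γ t ω * ‖gradient f (x t ω)‖ ^ 2 + ‖v t ω‖ ^ (1 + α) with hD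
  set L : ℝ := 1 + σ ^ 2 + (1 + C) * c₂ with hL
  have hL0 : 0 ≤ L := by positivity
  set a : ℕ → Ω → ℝ := fun t ω => κ * L * γ t ω ^ (1 + α) with ha
  have hzm := fun t => (hp.measurable_z_v hcont t).1
  have hvm := fun t => (hp.measurable_z_v hcont t).2
  have hgm := fun t => hp.measurable_gradient hcont t
  have hpw0 : ∀ t ω, 0 ≤ γ t ω ^ (1 + α) := fun t ω => Real.rpow_nonneg (hp.step_nonneg t ω) _
  have hpwm : ∀ t, Measurable[F t] fun ω => γ t ω ^ (1 + α) :=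
    fun t => (hp.measurable_step t).pow_const _
  have hVm : ∀ t, Measurable[F t] (V t) := fun t =>
    (((h.differentiable.continuous.measurable.comp (hzm t)).sub_const m).const_add 1).add
      (((measurable_norm.comp (hvm t)).pow_const _).const_mul K)
  have hDm : ∀ t, Measurable[F t] (D t) := fun t =>
    ((hp.measurable_step t).mul ((measurable_norm.comp (hgm t)).pow_const 2)).add
      ((measurable_norm.comp (hvm t)).pow_const _)
  have ham : ∀ t, Measurable[F t] (a t) := fun t => (hpwm t).const_mul _
  have hvp0 : ∀ t ω, 0 ≤ ‖v t ω‖ ^ (1 + α) := fun t ω => by positivity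
  have hγG0 : ∀ t ω, 0 ≤ γ t ω * ‖gradient f (x t ω)‖ ^ 2 :=
    fun t ω => mul_nonneg (hp.step_nonneg t ω) (by positivity)
  have hV1 : ∀ t ω, 1 ≤ V t ω := fun t ω => by
    have := mul_nonneg hK0 (hvp0 t ω)
    simp only [hV]; linarith [hm (z t ω)]
  have hGV : ∀ t ω, ‖gradient f (x t ω)‖ ^ 2 ≤ c₂ * V t ω := fun t ω => by
    rw [hp.x_eq]
    refine (hgrad _ _).trans (mul_le_mul_of_nonneg_left ?_ hc₂)
    have := mul_le_mul_of_nonneg_right hK (hvp0 t ω)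
    simp only [hV]; linarith
  have hVi : ∀ t, Integrable (V t) P := fun t =>
    Integrable.add (Integrable.add (integrable_const _)
      (Integrable.sub (hp.integrable_objective h t) (integrable_const _)))
      ((hp.integrable_rpow_norm_v h t).const_mul K)
  have hDi : ∀ t, Integrable (D t) P := fun t =>
    (hp.integrable_step_mul_sq h t).add (hp.integrable_rpow_norm_v h t)
  have hmain : ∀ t (φ : Ω → ℝ), Measurable[F t] φ → (∀ ω, 0 ≤ φ ω) → (∀ ω, φ ω ≤ 1) →
      ∫ ω, φ ω * V (t + 1) ω ∂P ≤ ∫ ω, φ ω * ((1 + a t ω) * V t ω - D t ω) ∂P := by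
    intro t φ hφm hφ0 hφ1
    have hφm' : Measurable φ := hφm.mono (F.le t) le_rfl
    have hG2 := (hp.memLp_gradient_x h t).norm.integrable_sq
    have hN2 := (hp.memLp_N h t).norm.integrable_sq
    -- Pairing with this `F t`-measurable vector is the centered noise term of the Lyapunov step;
    -- its integral vanishes.
    set u : Ω → E := fun ω => (φ ω * (γ t ω / (1 - β))) • gradient f (z t ω) with hu
    have hum : Measurable[F t] u :=
      (hφm.mul ((hp.measurable_step t).div_const _)).smul (hcont.measurable.comp (hzm t))
    have hub : MemLp u 2 P := by
      refine (memLp_gradient h (hp.memLp_z_v h t).1).smul_of_abs_le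
        (B := (1 + M) / (1 - β))
        (φ := fun ω => φ ω * (γ t ω / (1 - β)))
        ((hφm.mul ((hp.measurable_step t).div_const _)).mono (F.le t) le_rfl) fun ω => ?_
      have hβ' : 0 < 1 - β := by linarith
      have h1 : 0 ≤ γ t ω / (1 - β) := div_nonneg (hp.step_nonneg t ω) hβ'.le
      rw [abs_of_nonneg (mul_nonneg (hφ0 ω) h1)]
      refine (mul_le_of_le_one_left h1 (hφ1 ω)).trans ?_
      have := hp.step_le h.pos t ω
      gcongr
    have huN := hub.integrable_real_inner (hp.memLp_N h t)
    have huN0 := hp.integral_noise_eq t u hum huN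
    set ψ : Ω → ℝ := fun ω => φ ω * γ t ω ^ (1 + α) with hψ
    have hψm : Measurable[F t] ψ := hφm.mul (hpwm t)
    have hψ0 : ∀ ω, 0 ≤ ψ ω := fun ω => mul_nonneg (hφ0 ω) (hpw0 t ω)
    have hψM : ∀ ω, ψ ω ≤ M := fun ω =>
      (mul_le_of_le_one_left (hpw0 t ω) (hφ1 ω)).trans (hp.rpow_step_le t ω)
    have hψN := hp.integral_mul_sq_noise_le h hC hψm hψ0 hψM
    have hψNi := Integrable.mul_of_nonneg_of_le (hψm.mono (F.le t) le_rfl) hψ0 hψM hN2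
    have hψGi := Integrable.mul_of_nonneg_of_le (P := P) (hψm.mono (F.le t) le_rfl) hψ0 hψM
      (X := fun ω => σ ^ 2 + C * ‖gradient f (x t ω)‖ ^ 2)
      (Integrable.add (integrable_const _) (hG2.const_mul C))
    have hψ1i := Integrable.mul_of_nonneg_of_le (P := P) (hψm.mono (F.le t) le_rfl) hψ0 hψM
      (X := fun ω => 1 + ‖gradient f (x t ω)‖ ^ 2) (Integrable.add (integrable_const _) hG2)
    have hφVD := Integrable.mul_of_nonneg_of_le hφm' hφ0 hφ1 (X := fun ω => V t ω - D t ω)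
      ((hVi t).sub (hDi t))
    have haVi : Integrable (fun ω => ψ ω * V t ω) P :=
      Integrable.mul_of_nonneg_of_le (hψm.mono (F.le t) le_rfl) hψ0 hψM (hVi t)
    have hR1 : Integrable (fun ω => φ ω * (V t ω - D t ω)
        + κ * (ψ ω * (1 + ‖gradient f (x t ω)‖ ^ 2))) P :=
      hφVD.add (hψ1i.const_mul κ)
    have hR2 : Integrable (fun ω => φ ω * (V t ω - D t ω)
        + κ * (ψ ω * (1 + ‖gradient f (x t ω)‖ ^ 2)) + κ * (ψ ω * ‖N t ω‖ ^ 2)) P :=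
      hR1.add (hψNi.const_mul κ)
    calc ∫ ω, φ ω * V (t + 1) ω ∂P
        ≤ ∫ ω, (φ ω * (V t ω - D t ω) + κ * (ψ ω * (1 + ‖gradient f (x t ω)‖ ^ 2))
            + κ * (ψ ω * ‖N t ω‖ ^ 2) - ⟪u ω, N t ω⟫) ∂P := by
          refine integral_mono
            (Integrable.mul_of_nonneg_of_le hφm' hφ0 hφ1 (hVi (t + 1))) (hR2.sub huN) fun ω => ?_
          have h1 := hstep (γ t ω) (z t ω) (v t ω) (x t ω) (N t ω) (hp.step_nonneg t ω) (hp.x_eq t ω)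
          rw [← hp.z_succ, ← hp.v_succ] at h1
          have h2 := mul_le_mul_of_nonneg_left h1 (hφ0 ω)
          simp only [hV, hD, hψ, hu, inner_smul_left, RCLike.conj_to_real]
          linarith
      _ = ∫ ω, (φ ω * (V t ω - D t ω) + κ * (ψ ω * (1 + ‖gradient f (x t ω)‖ ^ 2))) ∂P
            + κ * ∫ ω, ψ ω * ‖N t ω‖ ^ 2 ∂P := by
          rw [integral_sub hR2 huN, huN0, sub_zero, integral_add hR1 (hψNi.const_mul κ),
            integral_const_mul]
      _ ≤ ∫ ω, (φ ω * (V t ω - D t ω) + κ * (ψ ω * (1 + ‖gradient f (x t ω)‖ ^ 2))) ∂P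
            + κ * ∫ ω, ψ ω * (σ ^ 2 + C * ‖gradient f (x t ω)‖ ^ 2) ∂P := by gcongr
      _ = ∫ ω, (φ ω * (V t ω - D t ω) + κ * (ψ ω * (1 + ‖gradient f (x t ω)‖ ^ 2))
            + κ * (ψ ω * (σ ^ 2 + C * ‖gradient f (x t ω)‖ ^ 2))) ∂P := by
          rw [← integral_const_mul, ← integral_add hR1 (hψGi.const_mul κ)]
      _ ≤ ∫ ω, φ ω * ((1 + a t ω) * V t ω - D t ω) ∂P := by
          refine integral_mono (hR1.add (hψGi.const_mul κ)) ?_ fun ω => ?_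
          · refine (hφVD.add (haVi.const_mul (κ * L))).congr (Eventually.of_forall fun ω => ?_)
            simp only [Pi.add_apply, ha, hψ]
            ring
          · have h1 : 1 + ‖gradient f (x t ω)‖ ^ 2 + (σ ^ 2 + C * ‖gradient f (x t ω)‖ ^ 2)
                ≤ L * V t ω := by
              have h2 := mul_le_mul_of_nonneg_left (hGV t ω) (show 0 ≤ 1 + C by linarith)
              have h3 := mul_le_mul_of_nonneg_left (hV1 t ω) (show 0 ≤ 1 + σ ^ 2 by positivity)
              simp only [hL]
              linarith
            have h4 := mul_le_mul_of_nonneg_left h1 (mul_nonneg hκ (hψ0 ω))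
            simp only [ha, hψ] at h4 ⊢
            linarith
  obtain ⟨hVlim, hDsum, R, hR⟩ := robbins_siegmund (F := F) hVm hDm ham
    (fun t ω => zero_le_one.trans (hV1 t ω)) (fun t ω => add_nonneg (hγG0 t ω) (hvp0 t ω))
    (fun t ω => mul_nonneg (mul_nonneg hκ hL0) (hpw0 t ω)) (M := κ * L * M)
    (fun n ω => by
      rw [← Finset.mul_sum]
      exact mul_le_mul_of_nonneg_left (hp.step_sum_le n ω) (mul_nonneg hκ hL0))
    hVi hDi hmain
  refine ⟨?_, R, fun n => le_trans ?_ (hR n)⟩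
  · filter_upwards [hVlim, hDsum] with ω ⟨l, hl⟩ hDω
    have hvsum : Summable fun t => ‖v t ω‖ ^ (1 + α) :=
      Summable.of_nonneg_of_le (hvp0 · ω) (fun t => le_add_of_nonneg_left (hγG0 t ω)) hDω
    have hv0 := hvsum.tendsto_atTop_zero
    refine ⟨⟨l - 1 - K * 0 + m, ?_⟩, ?_, ?_⟩
    · refine (((hl.sub_const 1).sub (hv0.const_mul K)).add_const m).congr fun t => ?_
      simp only [hV]; ring
    · rw [tendsto_zero_iff_norm_tendsto_zero]
      have h1 := hv0.rpow_const (p := (1 + α)⁻¹) (Or.inr (by positivity))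
      rw [Real.zero_rpow (by positivity)] at h1
      exact h1.congr fun t => Real.rpow_rpow_inv (norm_nonneg _) (by positivity)
    · exact Summable.of_nonneg_of_le (hγG0 · ω) (fun t => le_add_of_nonneg_right (hvp0 t ω)) hDω
  · exact integral_mono (integrable_finsetSum _ fun t _ => hp.integrable_step_mul_sq h t)
      (integrable_finsetSum _ fun t _ => hDi t)
      fun ω => Finset.sum_le_sum fun t _ => le_add_of_nonneg_right (hvp0 t ω)

lemma memLp_sum_noise (hp : IsMomentumProcess P F f α β c σ C M z₀ γ x z v N)
    (h : HolderGradient f α A) (n : ℕ) :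
    MemLp (fun ω => ∑ t ∈ Finset.range n, γ t ω • N t ω) 2 P :=
  memLp_finsetSum _ fun t _ => (hp.memLp_N h t).smul_of_abs_le (B := 1 + M)
    ((hp.measurable_step t).mono (F.le t) le_rfl)
    fun ω => by rw [abs_of_nonneg (hp.step_nonneg t ω)]; exact hp.step_le h.pos t ω

lemma measurable_sum_noise (hp : IsMomentumProcess P F f α β c σ C M z₀ γ x z v N) (n : ℕ) :
    Measurable[F n] fun ω => ∑ t ∈ Finset.range n, γ t ω • N t ω :=
  Finset.measurable_fun_sum _ fun t ht =>
    ((hp.measurable_step t).mono (F.mono (Finset.mem_range.1 ht).le) le_rfl).smul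
      ((hp.measurable_noise t).mono (F.mono (Finset.mem_range.1 ht)) le_rfl)

/-- The increments are orthogonal, so the second moments add up. In each, `γ²` is bounded by
`(1+M)γ^(1+α)` against `σ²` and by `(1+M)γ` against `C‖∇f(x)‖²`; the latter sum is bounded in mean
by `R`. -/
lemma integral_sq_sum_noise_le
    (hp : IsMomentumProcess P F f α β c σ C M z₀ γ x z v N)
    (h : HolderGradient f α A) (hC : 0 ≤ C) {R : ℝ}
    (hR : ∀ n, ∫ ω, ∑ t ∈ Finset.range n, γ t ω * ‖gradient f (x t ω)‖ ^ 2 ∂P ≤ R) (n : ℕ) :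
    ∫ ω, ‖∑ t ∈ Finset.range n, γ t ω • N t ω‖ ^ 2 ∂P ≤ (1 + M) * (σ ^ 2 * M + C * R) := by
  have hM := hp.bound_nonneg
  have hpwi : ∀ t, Integrable (fun ω => γ t ω ^ (1 + α)) P := fun t =>
    (integrable_const M).mono' (((hp.measurable_step t).mono (F.le t) le_rfl).pow_const
      _).aestronglyMeasurable (Eventually.of_forall fun ω => by
        rw [Real.norm_of_nonneg (Real.rpow_nonneg (hp.step_nonneg t ω) _)]
        exact hp.rpow_step_le t ω)
  set B : ℕ → Ω → ℝ := fun t ω =>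
    (1 + M) * (σ ^ 2 * γ t ω ^ (1 + α) + C * (γ t ω * ‖gradient f (x t ω)‖ ^ 2)) with hB
  have hBi : ∀ t, Integrable (B t) P := fun t =>
    (((hpwi t).const_mul (σ ^ 2)).add ((hp.integrable_step_mul_sq h t).const_mul C)).const_mul _
  have hrec : ∀ n, ∫ ω, ‖∑ t ∈ Finset.range n, γ t ω • N t ω‖ ^ 2 ∂P
      ≤ ∑ t ∈ Finset.range n, ∫ ω, B t ω ∂P := by
    intro n
    induction n with
    | zero => simp
    | succ n ih =>
      have hγm : Measurable (γ n) := (hp.measurable_step n).mono (F.le n) le_rfl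
      have hγb : ∀ ω, |γ n ω| ≤ 1 + M := fun ω => by
        rw [abs_of_nonneg (hp.step_nonneg n ω)]; exact hp.step_le h.pos n ω
      have hSm := hp.measurable_sum_noise n
      have hS := hp.memLp_sum_noise h n
      set S : Ω → E := fun ω => ∑ t ∈ Finset.range n, γ t ω • N t ω with hSdef
      have hu := hS.smul_of_abs_le hγm hγb
      have hcross := hu.integrable_real_inner (hp.memLp_N h n)
      have hcross0 := hp.integral_noise_eq n _ ((hp.measurable_step n).smul hSm) hcross
      have hsqm : Measurable[F n] fun ω => γ n ω ^ 2 := (hp.measurable_step n).pow_const 2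
      have hsqb : ∀ ω, γ n ω ^ 2 ≤ (1 + M) ^ 2 := fun ω =>
        pow_le_pow_left₀ (hp.step_nonneg n ω) (hp.step_le h.pos n ω) 2
      have hN := hp.integral_mul_sq_noise_le h hC hsqm (fun ω => sq_nonneg _) hsqb
      have hNi := Integrable.mul_of_nonneg_of_le (hsqm.mono (F.le n) le_rfl)
        (fun ω => sq_nonneg (γ n ω)) hsqb (hp.memLp_N h n).norm.integrable_sq
      have hGi := Integrable.mul_of_nonneg_of_le (P := P) (hsqm.mono (F.le n) le_rfl)
        (fun ω => sq_nonneg (γ n ω)) hsqb (X := fun ω => σ ^ 2 + C * ‖gradient f (x n ω)‖ ^ 2)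
        (Integrable.add (integrable_const _)
          ((hp.memLp_gradient_x h n).norm.integrable_sq.const_mul C))
      have hexp : ∀ ω, ‖∑ t ∈ Finset.range (n + 1), γ t ω • N t ω‖ ^ 2
          = ‖S ω‖ ^ 2 + 2 * ⟪γ n ω • S ω, N n ω⟫ + γ n ω ^ 2 * ‖N n ω‖ ^ 2 := by
        intro ω
        rw [Finset.sum_range_succ, norm_add_sq_real, inner_smul_right, inner_smul_left, norm_smul,
          mul_pow, Real.norm_eq_abs, sq_abs]
        simp [hSdef]
      have hle : ∫ ω, γ n ω ^ 2 * (σ ^ 2 + C * ‖gradient f (x n ω)‖ ^ 2) ∂P ≤ ∫ ω, B n ω ∂P := by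
        refine integral_mono hGi (hBi n) fun ω => ?_
        have h1 := mul_le_mul_of_nonneg_left (hp.sq_step_le h.pos h.le_one n ω) (sq_nonneg σ)
        have h2 : γ n ω ^ 2 ≤ (1 + M) * γ n ω := by
          rw [sq]
          exact mul_le_mul_of_nonneg_right (hp.step_le h.pos n ω) (hp.step_nonneg n ω)
        have h3 := mul_le_mul_of_nonneg_left h2
          (mul_nonneg hC (sq_nonneg ‖gradient f (x n ω)‖))
        simp only [hB]
        linarith
      have hi1 : Integrable (fun ω => ‖S ω‖ ^ 2 + 2 * ⟪γ n ω • S ω, N n ω⟫) P :=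
        hS.norm.integrable_sq.add (hcross.const_mul 2)
      simp_rw [hexp]
      rw [integral_add hi1 hNi, integral_add hS.norm.integrable_sq (hcross.const_mul 2),
        integral_const_mul, Finset.sum_range_succ]
      have hcross0' : ∫ ω, ⟪γ n ω • S ω, N n ω⟫ ∂P = 0 := hcross0
      rw [hcross0']
      linarith
  refine (hrec n).trans ?_
  have e1 : ∑ t ∈ Finset.range n, ∫ ω, B t ω ∂P
      = (1 + M) * (σ ^ 2 * ∫ ω, ∑ t ∈ Finset.range n, γ t ω ^ (1 + α) ∂P
        + C * ∫ ω, ∑ t ∈ Finset.range n, γ t ω * ‖gradient f (x t ω)‖ ^ 2 ∂P) := by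
    rw [integral_finsetSum _ fun t _ => hpwi t,
      integral_finsetSum _ fun t _ => hp.integrable_step_mul_sq h t, Finset.mul_sum,
      Finset.mul_sum, ← Finset.sum_add_distrib, Finset.mul_sum]
    refine Finset.sum_congr rfl fun t _ => ?_
    simp only [hB]
    rw [integral_const_mul, integral_add ((hpwi t).const_mul _)
      ((hp.integrable_step_mul_sq h t).const_mul C), integral_const_mul, integral_const_mul]
  have h2 : ∫ ω, ∑ t ∈ Finset.range n, γ t ω ^ (1 + α) ∂P ≤ M := by
    have := integral_mono (integrable_finsetSum _ fun t _ => hpwi t) (integrable_const M)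
      (fun ω => hp.step_sum_le n ω) (μ := P)
    simpa using this
  rw [e1]
  have := hR n
  gcongr

/-- The accumulated noise converges almost surely. -/
lemma ae_tendsto_sum_noise [FiniteDimensional ℝ E]
    (hp : IsMomentumProcess P F f α β c σ C M z₀ γ x z v N)
    (h : HolderGradient f α A) (hC : 0 ≤ C) {R : ℝ}
    (hR : ∀ n, ∫ ω, ∑ t ∈ Finset.range n, γ t ω * ‖gradient f (x t ω)‖ ^ 2 ∂P ≤ R) :
    ∀ᵐ ω ∂P, ∃ e, Tendsto (fun n => ∑ t ∈ Finset.range n, γ t ω • N t ω) atTop (𝓝 e) := by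
  set S : ℕ → Ω → E := fun n ω => ∑ t ∈ Finset.range n, γ t ω • N t ω with hSdef
  -- Scalar martingale convergence is applied in each direction; finite dimension reassembles the
  -- limit from an orthonormal basis.
  have hcoord : ∀ e : E, ∀ᵐ ω ∂P, ∃ l, Tendsto (fun n => ⟪e, S n ω⟫) atTop (𝓝 l) := by
    intro e
    have hi : ∀ n, MemLp (fun ω => ⟪e, S n ω⟫) 2 P := fun n =>
      (hp.memLp_sum_noise h n).const_inner e
    have hmart : Martingale (fun n ω => ⟪e, S n ω⟫) F P := by
      refine martingale_of_setIntegral_eq_succ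
        (fun n => ((hp.measurable_sum_noise n).const_inner).stronglyMeasurable)
        (fun n => (hi n).integrable one_le_two) fun n s hs => ?_
      have hs' := F.le n s hs
      set u : Ω → E := s.indicator fun ω => γ n ω • e with hu
      have hum : Measurable[F n] u := ((hp.measurable_step n).smul_const e).indicator hs
      have hub : MemLp u 2 P := MemLp.indicator hs' ((memLp_const e).smul_of_abs_le (B := 1 + M)
        ((hp.measurable_step n).mono (F.le n) le_rfl)
        fun ω => by rw [abs_of_nonneg (hp.step_nonneg n ω)]; exact hp.step_le h.pos n ω)
      have huN := hub.integrable_real_inner (hp.memLp_N h n)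
      have h0 := hp.integral_noise_eq n u hum huN
      rw [← integral_indicator hs', ← integral_indicator hs']
      have h1 : ∀ ω, s.indicator (fun ω => ⟪e, S (n + 1) ω⟫) ω
          = s.indicator (fun ω => ⟪e, S n ω⟫) ω + ⟪u ω, N n ω⟫ := by
        intro ω
        by_cases hω : ω ∈ s
        · simp [hu, hω, hSdef, Finset.sum_range_succ, inner_add_right, inner_smul_left,
            inner_smul_right]
        · simp [hu, hω]
      simp_rw [h1]
      rw [integral_add (((hi n).integrable one_le_two).indicator hs') huN, h0, add_zero]
    refine hmart.exists_ae_tendsto_of_sq_le (fun n => (hi n).integrable_sq)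
      (B := ‖e‖ ^ 2 * ((1 + M) * (σ ^ 2 * M + C * R))) fun n => ?_
    calc ∫ ω, ⟪e, S n ω⟫ ^ 2 ∂P ≤ ∫ ω, ‖e‖ ^ 2 * ‖S n ω‖ ^ 2 ∂P := by
          refine integral_mono (hi n).integrable_sq
            ((hp.memLp_sum_noise h n).norm.integrable_sq.const_mul _) fun ω => ?_
          have := abs_real_inner_le_norm e (S n ω)
          simp only
          rw [← sq_abs, ← mul_pow]
          exact pow_le_pow_left₀ (abs_nonneg _) this 2
      _ = ‖e‖ ^ 2 * ∫ ω, ‖S n ω‖ ^ 2 ∂P := integral_const_mul _ _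
      _ ≤ _ := by
          have := hp.integral_sq_sum_noise_le h hC hR n
          gcongr
  set b := stdOrthonormalBasis ℝ E
  filter_upwards [ae_all_iff.2 fun i => hcoord (b i)] with ω hω
  choose l hl using hω
  refine ⟨∑ i, l i • b i, ?_⟩
  refine (tendsto_finsetSum _ fun i _ => (hl i).smul_const (b i)).congr fun n => ?_
  exact b.sum_repr' (S n ω)

/-- Almost sure convergence on the event where the stepsizes have infinite sum. -/
lemma ae_tendsto [FiniteDimensional ℝ E]
    (hp : IsMomentumProcess P F f α β c σ C M z₀ γ x z v N)
    (h : HolderGradient f α A) (hf : BddBelow (Set.range f)) (hC : 0 ≤ C)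
    (hβ : 0 ≤ β) (hβ1 : β < 1) :
    ∀ᵐ ω ∂P, Tendsto (fun n => ∑ t ∈ Finset.range n, γ t ω) atTop atTop →
      (∃ l, Tendsto (fun t => f (x t ω)) atTop (𝓝 l)) ∧
      Tendsto (fun t => gradient f (x t ω)) atTop (𝓝 0) ∧
      Tendsto (fun t => dist (x (t + 1) ω) (x t ω)) atTop (𝓝 0) := by
  obtain ⟨m, hm⟩ := hf
  obtain ⟨hae, R, hR⟩ := hp.ae_lyapunov h (fun y => hm ⟨y, rfl⟩) hC hβ hβ1
  filter_upwards [hae, hp.ae_tendsto_sum_noise h hC hR] with ω ⟨⟨l, hl⟩, hv, hsum⟩ ⟨e, he⟩ hdiv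
  have hα := h.pos
  have hγ0 : Tendsto (fun t => γ t ω) atTop (𝓝 0) := by
    have h0 : Tendsto (fun t => γ t ω ^ (1 + α)) atTop (𝓝 0) :=
      (summable_of_sum_range_le (fun t => Real.rpow_nonneg (hp.step_nonneg t ω) _)
        (fun n => hp.step_sum_le n ω)).tendsto_atTop_zero
    have h1 := h0.rpow_const (p := (1 + α)⁻¹) (Or.inr (by positivity))
    rw [Real.zero_rpow (by positivity)] at h1
    exact h1.congr fun t => Real.rpow_rpow_inv (hp.step_nonneg t ω) (by positivity)
  obtain ⟨h1, h2, h3⟩ := h.tendsto_of_path hβ1 (fun t => hp.step_nonneg t ω) hγ0 hdiv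
    (fun t => hp.z_succ t ω) (fun t => hp.x_eq t ω) hv hl he hsum
  exact ⟨⟨l, h1⟩, h2, h3⟩

end IsMomentumProcess

end Convergence

/-! ### Noise moments of an oracle with an independent sample. -/

section Oracle

open scoped RealInnerProductSpace ENNReal

variable {E : Type*} [NormedAddCommGroup E]
  [MeasurableSpace E] [BorelSpace E] [SecondCountableTopology E]
  {Ω S T : Type*} {mΩ : MeasurableSpace Ω} [MeasurableSpace S] [MeasurableSpace T]
  {P : Measure Ω} [IsProbabilityMeasure P] {Y : Ω → T} {ξ : Ω → S} {X : T → E} {g : E → S → E}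
  {h : E → E}

/-- With `Y` frozen, the query point `X (Y ω)` is deterministic and the pointwise variance bound
applies. The next lemma treats the mean in the same way. -/
lemma lintegral_mul_sq_oracle_sub_le (hYξ : IndepFun Y ξ P) (hY : Measurable Y)
    (hξ : Measurable ξ) (hX : Measurable X) (hg : Measurable (Function.uncurry g))
    (hh : Measurable h) {σ C : ℝ}
    (hvar : ∀ x, Integrable (fun ω => ‖g x (ξ ω) - h x‖ ^ 2) P ∧
      ∫ ω, ‖g x (ξ ω) - h x‖ ^ 2 ∂P ≤ σ ^ 2 + C * ‖h x‖ ^ 2) {q : T → ℝ≥0∞} (hq : Measurable q) :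
    ∫⁻ ω, q (Y ω) * ‖g (X (Y ω)) (ξ ω) - h (X (Y ω))‖ₑ ^ 2 ∂P
      ≤ ∫⁻ ω, q (Y ω) * ENNReal.ofReal (σ ^ 2 + C * ‖h (X (Y ω))‖ ^ 2) ∂P := by
  have hgm : Measurable fun p : T × S => ‖g (X p.1) p.2 - h (X p.1)‖ₑ ^ 2 :=
    (((hg.comp ((hX.comp measurable_fst).prodMk measurable_snd)).sub
      (hh.comp (hX.comp measurable_fst))).enorm).pow_const 2
  rw [hYξ.lintegral_prodMk hY hξ
    (φ := fun p => q p.1 * ‖g (X p.1) p.2 - h (X p.1)‖ₑ ^ 2) ((hq.comp measurable_fst).mul hgm)]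
  refine lintegral_mono fun ω => ?_
  change ∫⁻ ω', q (Y ω) * ‖g (X (Y ω)) (ξ ω') - h (X (Y ω))‖ₑ ^ 2 ∂P ≤ _
  have hgω : Measurable fun ω' => ‖g (X (Y ω)) (ξ ω') - h (X (Y ω))‖ₑ ^ 2 :=
    hgm.comp (measurable_prodMk_left.comp hξ)
  rw [lintegral_const_mul _ hgω]
  gcongr
  obtain ⟨h1, h2⟩ := hvar (X (Y ω))
  refine le_trans (le_of_eq ?_) (ENNReal.ofReal_le_ofReal h2)
  rw [ofReal_integral_eq_lintegral_ofReal h1 (Eventually.of_forall fun ω' => sq_nonneg _)]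
  refine lintegral_congr fun ω' => ?_
  rw [ENNReal.ofReal_pow (norm_nonneg _), ofReal_norm]

lemma integral_inner_oracle_sub_eq_zero [InnerProductSpace ℝ E] [CompleteSpace E]
    (hYξ : IndepFun Y ξ P) (hY : Measurable Y)
    (hξ : Measurable ξ) (hX : Measurable X) (hg : Measurable (Function.uncurry g))
    (hh : Measurable h)
    (hmean : ∀ x, Integrable (fun ω => g x (ξ ω)) P ∧ ∫ ω, g x (ξ ω) ∂P = h x)
    {u : T → E} (hu : Measurable u)
    (hint : Integrable (fun ω => ⟪u (Y ω), g (X (Y ω)) (ξ ω) - h (X (Y ω))⟫) P) :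
    ∫ ω, ⟪u (Y ω), g (X (Y ω)) (ξ ω) - h (X (Y ω))⟫ ∂P = 0 := by
  rw [hYξ.integral_prodMk hY hξ (φ := fun p => ⟪u p.1, g (X p.1) p.2 - h (X p.1)⟫)
    ((hu.comp measurable_fst).inner
      ((hg.comp ((hX.comp measurable_fst).prodMk measurable_snd)).sub
        (hh.comp (hX.comp measurable_fst)))) hint]
  refine integral_eq_zero_of_ae (Eventually.of_forall fun ω => ?_)
  obtain ⟨h1, h2⟩ := hmean (X (Y ω))
  have h3 : Integrable (fun ω' => g (X (Y ω)) (ξ ω') - h (X (Y ω))) P :=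
    h1.sub (integrable_const _)
  simp only [Pi.zero_apply]
  rw [integral_inner h3, integral_sub h1 (integrable_const _), h2]
  simp

end Oracle

/-! ### Truncated stepsizes, and the method in momentum coordinates. -/

section Iterates

variable {d : ℕ} {Ω S : Type*} {mΩ : MeasurableSpace Ω} [MeasurableSpace S]

/-- The history generated by the stepsizes and the samples, as a filtration. -/
def sumFiltration {γ : ℕ → Ω → ℝ} {ξ : ℕ → Ω → S} (hγ : ∀ t, Measurable (γ t))
    (hξ : ∀ t, Measurable (ξ t)) : Filtration ℕ mΩ where
  seq := sumHistory γ ξ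
  mono' := fun _ _ hst => sup_le_sup
    (iSup_mono fun _ => iSup_mono' fun hi => ⟨hi.trans hst, le_rfl⟩)
    (iSup_mono fun _ => iSup_mono' fun hi => ⟨hi.trans_le hst, le_rfl⟩)
  le' := fun _ => sup_le (iSup₂_le fun i _ => (hγ i).comap_le) (iSup₂_le fun i _ => (hξ i).comap_le)

lemma measurable_sumHistory_step {γ : ℕ → Ω → ℝ} {ξ : ℕ → Ω → S} {i t : ℕ} (hit : i ≤ t) :
    Measurable[sumHistory γ ξ t] (γ i) := by
  rw [measurable_iff_comap_le]
  exact (le_iSup₂ (f := fun (i : ℕ) (_ : i ≤ t) => MeasurableSpace.comap (γ i) inferInstance)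
    i hit).trans le_sup_left

lemma measurable_sumHistory_sample {γ : ℕ → Ω → ℝ} {ξ : ℕ → Ω → S} {i t : ℕ} (hit : i < t) :
    Measurable[sumHistory γ ξ t] (ξ i) := by
  rw [measurable_iff_comap_le]
  exact (le_iSup₂ (f := fun (i : ℕ) (_ : i < t) => MeasurableSpace.comap (ξ i) inferInstance)
    i hit).trans le_sup_right

/-- The positive parts of the stepsizes, stopped before the sum of their `p`-th powers
exceeds `M`. -/
noncomputable def truncatedStep (γ : ℕ → Ω → ℝ) (p M : ℝ) (t : ℕ) (ω : Ω) : ℝ :=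
  if ∑ i ∈ Finset.range (t + 1), max (γ i ω) 0 ^ p ≤ M then max (γ t ω) 0 else 0

lemma truncatedStep_nonneg (γ : ℕ → Ω → ℝ) (p M : ℝ) (t : ℕ) (ω : Ω) :
    0 ≤ truncatedStep γ p M t ω := by
  unfold truncatedStep
  split_ifs
  · exact le_max_right _ _
  · exact le_rfl

/-- If the budget holds at the last index, all terms are dominated by positive parts; otherwise the
last term is `0 ^ p = 0` and induction applies. -/
lemma sum_truncatedStep_rpow_le (γ : ℕ → Ω → ℝ) {p M : ℝ} (hp : 0 < p) (hM : 0 ≤ M) (n : ℕ)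
    (ω : Ω) : ∑ t ∈ Finset.range n, truncatedStep γ p M t ω ^ p ≤ M := by
  induction n with
  | zero => simpa
  | succ n ih =>
    by_cases hn : ∑ i ∈ Finset.range (n + 1), max (γ i ω) 0 ^ p ≤ M
    · refine (Finset.sum_le_sum fun t _ => ?_).trans hn
      refine Real.rpow_le_rpow (truncatedStep_nonneg _ _ _ _ _) ?_ hp.le
      unfold truncatedStep
      split_ifs
      · exact le_rfl
      · exact le_max_right _ _
    · rw [Finset.sum_range_succ, truncatedStep, if_neg hn, Real.zero_rpow hp.ne', add_zero]
      exact ih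

lemma truncatedStep_eq {γ : ℕ → Ω → ℝ} {p M : ℝ} {ω : Ω} (h0 : ∀ t, 0 ≤ γ t ω)
    (hM : ∀ n, ∑ i ∈ Finset.range n, γ i ω ^ p ≤ M) (t : ℕ) :
    truncatedStep γ p M t ω = γ t ω := by
  unfold truncatedStep
  simp only [max_eq_left (h0 _)]
  exact if_pos (hM (t + 1))

lemma measurable_truncatedStep {γ : ℕ → Ω → ℝ} {ξ : ℕ → Ω → S} (p M : ℝ) (t : ℕ) :
    Measurable[sumHistory γ ξ t] (truncatedStep γ p M t) := by
  have hm : ∀ i ≤ t, Measurable[sumHistory γ ξ t] fun ω => max (γ i ω) 0 := fun i hi =>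
    (measurable_sumHistory_step hi).max measurable_const
  refine Measurable.ite ?_ (hm t le_rfl) measurable_const
  have hsum : Measurable[sumHistory γ ξ t]
      fun ω => ∑ i ∈ Finset.range (t + 1), max (γ i ω) 0 ^ p :=
    Finset.measurable_fun_sum _ fun i hi =>
      (hm i (Nat.lt_succ_iff.1 (Finset.mem_range.1 hi))).pow_const p
  exact hsum measurableSet_Iic

local notation "E" => EuclideanSpace ℝ (Fin d)

lemma measurable_sumState {F : Filtration ℕ mΩ} {β s : ℝ} {g : E → S → E} {x₀ : E}
    {γ : ℕ → Ω → ℝ} {ξ : ℕ → Ω → S} (hg : Measurable (Function.uncurry g))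
    (hγ : ∀ t, Measurable[F t] (γ t)) (hξ : ∀ t, Measurable[F (t + 1)] (ξ t)) (t : ℕ) :
    Measurable[F t] fun ω => sumState β s g x₀ (fun i => γ i ω) (fun i => ξ i ω) t := by
  induction t with
  | zero => exact measurable_const
  | succ t ih =>
    have hm := F.mono (Nat.le_succ t)
    have hst := ih.mono hm le_rfl
    have hγt := (hγ t).mono hm le_rfl
    have hx := measurable_fst.comp hst
    have hy := measurable_snd.comp hst
    have hG := hg.comp (hx.prodMk (hξ t))
    have hys := hx.sub ((hγt.const_mul s).smul hG)
    exact ((hx.sub (hγt.smul hG)).add ((hys.sub hy).const_smul β)).prodMk hys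

/-- The momentum method is a momentum process. -/
lemma isMomentumProcess_sumIterate {P : Measure Ω} [IsProbabilityMeasure P] {F : Filtration ℕ mΩ}
    {f : E → ℝ} (hf' : Continuous (gradient f)) {α β s σ C M : ℝ} (hβ1 : β < 1)
    {g : E → S → E} (hg : Measurable (Function.uncurry g)) {x₀ : E}
    {γ : ℕ → Ω → ℝ} {ξ : ℕ → Ω → S} (hξm : ∀ t, Measurable (ξ t))
    (hmean : ∀ t x, Integrable (fun ω => g x (ξ t ω)) P ∧ ∫ ω, g x (ξ t ω) ∂P = gradient f x)
    (hvar : ∀ t x, Integrable (fun ω => ‖g x (ξ t ω) - gradient f x‖ ^ 2) P ∧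
      ∫ ω, ‖g x (ξ t ω) - gradient f x‖ ^ 2 ∂P ≤ σ ^ 2 + C * ‖gradient f x‖ ^ 2)
    (hγ : ∀ t, Measurable[F t] (γ t)) (hξ : ∀ t, Measurable[F (t + 1)] (ξ t))
    (hindep : ∀ t, Indep (MeasurableSpace.comap (ξ t) inferInstance) (F t) P)
    (hγ0 : ∀ t ω, 0 ≤ γ t ω)
    (hγM : ∀ n ω, ∑ t ∈ Finset.range n, γ t ω ^ (1 + α) ≤ M) :
    ∃ z v N, IsMomentumProcess P F f α β (1 + β * s - s) σ C M x₀ γ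
      (sumIterate β s g x₀ γ ξ) z v N := by
  set st : ℕ → Ω → E × E := fun t ω => sumState β s g x₀ (fun i => γ i ω) (fun i => ξ i ω) t
    with hst
  have hstm : ∀ t, Measurable[F t] (st t) := measurable_sumState hg hγ hξ
  have hxm : ∀ t, Measurable[F t] fun ω => (st t ω).1 := fun t => measurable_fst.comp (hstm t)
  have hβ' : 1 - β ≠ 0 := by linarith
  -- The whole past is encoded as the identity map from `Ω` to `Ω` with the σ-algebra `F t`: its
  -- independent partner is `ξ t`, and functions of it are exactly the `F t`-measurable ones.
  have hid : ∀ t, @IndepFun Ω Ω S mΩ (F t) _ id (ξ t) P := fun t => by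
    have h1 : Indep (MeasurableSpace.comap id (F t)) (MeasurableSpace.comap (ξ t) inferInstance)
        P := by
      rw [MeasurableSpace.comap_id]
      exact (hindep t).symm
    exact h1
  have hidm : ∀ t, @Measurable Ω Ω mΩ (F t) id := fun t => measurable_id'' (F.le t)
  have hs1 : ∀ t ω, (st (t + 1) ω).1 = (st t ω).1 - γ t ω • g (st t ω).1 (ξ t ω)
      + β • ((st t ω).1 - (s * γ t ω) • g (st t ω).1 (ξ t ω) - (st t ω).2) := fun t ω => rfl
  have hs2 : ∀ t ω, (st (t + 1) ω).2 = (st t ω).1 - (s * γ t ω) • g (st t ω).1 (ξ t ω) :=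
    fun t ω => rfl
  refine ⟨fun t ω => (st t ω).1 + (β / (1 - β)) • ((st t ω).1 - (st t ω).2),
    fun t ω => (st t ω).1 - (st t ω).2,
    fun t ω => g (st t ω).1 (ξ t ω) - gradient f (st t ω).1, ?_⟩
  refine ⟨hγ, hγ0, hγM, fun t => ?_, fun ω => ?_, fun ω => ?_, fun t ω => ?_, fun t ω => ?_,
    fun t ω => ?_, fun t q hq => ?_, fun t u hu hint => ?_⟩
  · have hx := (hxm t).mono (F.mono (Nat.le_succ t)) le_rfl
    exact (hg.comp (hx.prodMk (hξ t))).sub (hf'.measurable.comp hx)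
  · simp [hst, sumState]
  · simp [hst, sumState]
  · change _ = _ - _ • (gradient f (st t ω).1 + _)
    rw [add_sub_cancel, hs1, hs2]
    match_scalars <;> field_simp <;> ring
  · change _ = _ - _ • (gradient f (st t ω).1 + _)
    rw [add_sub_cancel, hs1, hs2]
    module
  · change (st t ω).1 = _
    rw [add_sub_cancel_right]
  · exact @lintegral_mul_sq_oracle_sub_le E _ _ _ _ Ω S Ω mΩ _ (F t) P _ id (ξ t)
      (fun ω => (st t ω).1) g (gradient f) (hid t) (hidm t) (hξm t) (hxm t) hg hf'.measurable
      σ C (hvar t) q hq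
  · exact @integral_inner_oracle_sub_eq_zero E _ _ _ _ Ω S Ω mΩ _ (F t) P _ id (ξ t)
      (fun ω => (st t ω).1) g (gradient f) _ _ (hid t) (hidm t) (hξm t) (hxm t) hg hf'.measurable
      (hmean t) u hu hint

end Iterates

/-! ### Removing the truncation, and conclusion. -/

theorem theorem3 {d : ℕ} {Ω S : Type*} [MeasurableSpace Ω] [MeasurableSpace S]
    (P : Measure Ω) [IsProbabilityMeasure P]
    -- the cost function: bounded below, with Hölder continuous gradient
    (f : EuclideanSpace ℝ (Fin d) → ℝ)
    (hf : ContDiff ℝ 1 f) (hf_bdd : BddBelow (Set.range f))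
    (α A : ℝ) (hα_pos : 0 < α) (hα_le : α ≤ 1) (hA : 0 < A)
    (hf_holder : ∀ x y : EuclideanSpace ℝ (Fin d),
      ‖gradient f x - gradient f y‖ ≤ A * ‖x - y‖ ^ α)
    -- the samples and the stochastic oracle
    (ξ : ℕ → Ω → S) (hξ : ∀ t, Measurable (ξ t))
    (g : EuclideanSpace ℝ (Fin d) → S → EuclideanSpace ℝ (Fin d))
    (hg : Measurable (Function.uncurry g))
    (hg_unbiased : ∀ (t : ℕ) (x : EuclideanSpace ℝ (Fin d)),
      Integrable (fun ω => g x (ξ t ω)) P ∧ ∫ ω, g x (ξ t ω) ∂P = gradient f x)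
    (σ C : ℝ) (hσ : 0 < σ) (hC : 0 < C)
    (hg_var : ∀ (t : ℕ) (x : EuclideanSpace ℝ (Fin d)),
      Integrable (fun ω => ‖g x (ξ t ω) - gradient f x‖ ^ 2) P ∧
        ∫ ω, ‖g x (ξ t ω) - gradient f x‖ ^ 2 ∂P ≤ σ ^ 2 + C * ‖gradient f x‖ ^ 2)
    (hξ_indep : iIndepFun ξ P)
    -- the stochastic stepsizes
    (γ : ℕ → Ω → ℝ) (hγ : ∀ t, Measurable (γ t))
    (hγ_nonneg : ∀ᵐ ω ∂P, ∀ t, 0 ≤ γ t ω)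
    (hγ_sum : ∀ᵐ ω ∂P, Tendsto (fun n => ∑ t ∈ Finset.range n, γ t ω) atTop atTop)
    (hγ_pow : ∀ᵐ ω ∂P, Summable (fun t => γ t ω ^ (1 + α)))
    (hξ_history : ∀ t,
      Indep (MeasurableSpace.comap (ξ t) inferInstance) (sumHistory γ ξ t) P)
    -- the parameters of the method
    (β s : ℝ) (hβ_nonneg : 0 ≤ β) (hβ_lt : β < 1) (hs : 0 ≤ s)
    (x₀ : EuclideanSpace ℝ (Fin d)) :
    (∀ᵐ ω ∂P, ∃ l : ℝ,
      Tendsto (fun t => f (sumIterate β s g x₀ γ ξ t ω)) atTop (𝓝 l)) ∧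
    (∀ᵐ ω ∂P,
      Tendsto (fun t => gradient f (sumIterate β s g x₀ γ ξ t ω)) atTop (𝓝 0)) ∧
    ((∀ a b : ℝ, a < b →
        {x : EuclideanSpace ℝ (Fin d) | gradient f x = 0 ∧ a ≤ f x ∧ f x ≤ b}.Finite) →
      Tendsto f (Bornology.cobounded (EuclideanSpace ℝ (Fin d))) atTop →
      ∀ᵐ ω ∂P, ∃ x : EuclideanSpace ℝ (Fin d),
        Tendsto (fun t => sumIterate β s g x₀ γ ξ t ω) atTop (𝓝 x)) := by
  have h : HolderGradient f α A :=
    ⟨hf.differentiable one_ne_zero, hα_pos, hα_le, hA, hf_holder⟩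
  have hcont := h.uniformContinuous.continuous
  have key : ∀ᵐ ω ∂P,
      (∃ l : ℝ, Tendsto (fun t => f (sumIterate β s g x₀ γ ξ t ω)) atTop (𝓝 l)) ∧
      Tendsto (fun t => gradient f (sumIterate β s g x₀ γ ξ t ω)) atTop (𝓝 0) ∧
      Tendsto (fun t => dist (sumIterate β s g x₀ γ ξ (t + 1) ω)
        (sumIterate β s g x₀ γ ξ t ω)) atTop (𝓝 0) := by
    -- Integer levels suffice and keep the exceptional sets countable in number. Truncation
    -- preserves adaptedness, hence independence of `ξ t` from the past, but may destroy divergence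
    -- of the sum, which therefore stays a pathwise premise.
    have htrunc : ∀ M : ℕ, ∀ᵐ ω ∂P,
        Tendsto (fun n => ∑ t ∈ Finset.range n, truncatedStep γ (1 + α) M t ω) atTop atTop →
        (∃ l : ℝ, Tendsto (fun t => f (sumIterate β s g x₀ (truncatedStep γ (1 + α) M) ξ t ω))
          atTop (𝓝 l)) ∧
        Tendsto (fun t => gradient f (sumIterate β s g x₀ (truncatedStep γ (1 + α) M) ξ t ω))
          atTop (𝓝 0) ∧
        Tendsto (fun t => dist (sumIterate β s g x₀ (truncatedStep γ (1 + α) M) ξ (t + 1) ω)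
          (sumIterate β s g x₀ (truncatedStep γ (1 + α) M) ξ t ω)) atTop (𝓝 0) := by
      intro M
      obtain ⟨z, v, N, hp⟩ := isMomentumProcess_sumIterate (F := sumFiltration hγ hξ)
        (γ := truncatedStep γ (1 + α) M) (α := α) (M := M) (x₀ := x₀) (s := s)
        hcont hβ_lt hg hξ hg_unbiased hg_var
        (measurable_truncatedStep (ξ := ξ) (1 + α) M)
        (fun t => measurable_sumHistory_sample (Nat.lt_succ_self t)) hξ_history
        (truncatedStep_nonneg γ (1 + α) M)
        (sum_truncatedStep_rpow_le γ (by linarith) M.cast_nonneg)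
      exact hp.ae_tendsto h hf_bdd hC.le hβ_nonneg hβ_lt
    filter_upwards [ae_all_iff.2 htrunc, hγ_nonneg, hγ_sum, hγ_pow] with ω hω h0 hdiv hpow
    obtain ⟨M, hM⟩ := exists_nat_ge (∑' t, γ t ω ^ (1 + α))
    -- For `M` above the full sum nothing is truncated, so both methods coincide along this path.
    have heq : ∀ t, truncatedStep γ (1 + α) M t ω = γ t ω := truncatedStep_eq h0 fun n =>
      (hpow.sum_le_tsum _ fun t _ => Real.rpow_nonneg (h0 t) _).trans hM
    have hωM := hω M
    simp only [sumIterate, heq] at hωM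
    exact hωM hdiv
  refine ⟨key.mono fun ω hω => hω.1, key.mono fun ω hω => hω.2.1, fun hfin hcoer => ?_⟩
  filter_upwards [key] with ω ⟨⟨l, hl⟩, hgrad, hstep⟩
  exact exists_tendsto_of_finite_critical hf.continuous hcont hfin hcoer hl hgrad hstep
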